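/- Let $F$ be a field of characteristic different from $2$. **Symmetric compositions.** A symmetric composition over $F$ (always of dimension $8$) is a triple $\Sigma=(S,n,\star)$, where $S$ is an $8$-dimensional $F$-vector space, $n$ is a quadratic form on $S$ with nondegenerate polar form $b_n$, and $\star\colon S\times S\to S$ is an $F$-bilinear map such that $n(x\star y)=n(x)n(y)$ and $b_n(x\star y,z)=b_n(x,y\star z)$ for all $x,y,z\in S$. An isomorphism of symmetric compositions is a linear bijection compatible with $n$ and $\star$. **Cyclic compositions.** A cyclic composition $\Gamma=(V,L,Q,\rho,*)$ over $F$ (of dimension $8$) consists of a cubic étale $F$-algebra $L$, an $F$-automorphism $\rho$ of $L$ of order $3$, a free $L$-module $V$ of rank $8$, a quadratic form $Q\colon V\to L$ with nondegenerate polar form $b_Q$, and an $F$-bilinear map $*\colon V\times V\to V$ such that, for all $x,y,z\in V$ and $\lambda\in L$, $$(\lambda x)*y=\rho(\lambda)(x*y),\qquad x*(\lambda y)=\rho^2(\lambda)(x*y),\qquad Q(x*y)=\rho(Q(x))\,\rho^2(Q(y)),$$ $$b_Q(x*y,z)=\rho\bigl(b_Q(y*z,x)\bigr)=\rho^2\bigl(b_Q(z*x,y)\bigr).$$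 An $L$-linear isotopy $\Gamma'\to\Gamma$ between cyclic compositions $\Gamma'=(V',L,Q',\rho,*')$ and $\Gamma=(V,L,Q,\rho,*)$ is an $L$-linear bijection $f\colon V'\to V$ for which there exists $\mu\in L^\times$ with $$Q(f(x))=\rho(\mu)\rho^2(\mu)Q'(x)\quad\text{and}\quad f(x)*f(y)=\mu f(x*'y)\qquad\text{for all }x,y\in V'.$$ For a symmetric composition $\Sigma$, let $\widehat\rho=\mathrm{Id}_S\otimes\rho$ on $S\otimes_FL$. Then $\Sigma\otimes(L,\rho)=(S\otimes_FL,L,n_L,\rho,*)$ denotes the cyclic composition with $n_L$ the scalar extension of $n$ and $x*y=\widehat\rho(x)\star\widehat\rho^{\,2}(y)$, where $\star$ is extended $L$-bilinearly to $S\otimes_FL$. **The algebra $\operatorname{End}\Gamma$.** Let $\Gamma=(V,L,Q,\rho,*)$ be a cyclic composition over $F$ with $L$ a field, and let $\theta=\rho^2$. For $\nu\in\{\rho,\theta\}$, let ${}^\nu V=\{{}^\nu x\mid x\in V\}$ be the twisted $L$-vector space with ${}^\nu(\lambda x)=\nu(\lambda)\,{}^\nu x$. For $f\in\operatorname{End}_LV$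 let ${}^\nu f\in\operatorname{End}_L({}^\nu V)$ be given by ${}^\nu f({}^\nu x)={}^\nu(f(x))$, and for a ring automorphism $\varphi$ of $\operatorname{End}_LV$ let ${}^\nu\varphi({}^\nu f)={}^\nu(\varphi(f))$. Let $\sigma_Q$ be the involution on $\operatorname{End}_LV$ adjoint to $b_Q$. Let $$\alpha_{*0}\colon C_0(V,Q)\to\operatorname{End}_L({}^\rho V)\times\operatorname{End}_L({}^\theta V)$$ be the restriction to the even Clifford algebra of the $L$-algebra homomorphism $C(V,Q)\to\operatorname{End}_L({}^\rho V\oplus{}^\theta V)$ sending $x\in V$ to the map $({}^\rho y,{}^\theta z)\mapsto({}^\rho(z*x),{}^\theta(x*y))$. Identify the Clifford algebra $C(\operatorname{End}_LV,\sigma_Q)$ with $C_0(V,Q)$ so that its canonical linear map from $\operatorname{End}_LV$ sends $x\otimes y=[z\mapsto x\,b_Q(y,z)]$ to $x\cdot y$. The group $\operatorname{Aut}_F(\operatorname{End}\Gamma)$ consists of the $F$-algebra automorphisms $\varphi$ of $\operatorname{End}_LV$ which commute with $\sigma_Q$, whose restriction to the center $L$ commutes with $\rho$, and which satisfy $\alpha_{*0}\circ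 C(\varphi)=({}^\rho\varphi\times{}^\theta\varphi)\circ\alpha_{*0}$. Here $C(\varphi)$ is the ring automorphism of $C(\operatorname{End}_LV,\sigma_Q)$ induced by $\varphi$, i.e. the one compatible with $\varphi$ and the canonical linear map from $\operatorname{End}_LV$. If $\Sigma$ is a symmetric composition over $F$ and $f\colon\Sigma\otimes(L,\rho)\to\Gamma$ is an $L$-linear isotopy, let $\tau_{(\Sigma,f)}$ be the automorphism $g\mapsto t\circ g\circ t^{-1}$ of $\operatorname{End}_LV$, where $t=f\circ\widehat\rho\circ f^{-1}$. **Theorem.** Let $\Gamma=(V,L,Q,\rho,*)$ be a cyclic composition over $F$ with $L$ a field. For every symmetric composition $\Sigma$ over $F$ and every $L$-linear isotopy $f\colon\Sigma\otimes(L,\rho)\to\Gamma$, the automorphism $\tau_{(\Sigma,f)}$ lies in $\operatorname{Aut}_F(\operatorname{End}\Gamma)$. The assignment $\Sigma\mapsto\tau_{(\Sigma,f)}$ induces a well-defined bijection from the set of isomorphism classes of symmetric compositions $\Sigma$ over $F$ for which there exists an $L$-linear isotopy $f\colon\Sigma\otimes(L,\rho)\to\Gamma$ onto the set of conjugacy classes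 in $\operatorname{Aut}_F(\operatorname{End}\Gamma)$ of automorphisms $\tau$ such that $\tau^3=\mathrm{Id}$ and $\tau|_L=\rho$. In particular, the conjugacy class of $\tau_{(\Sigma,f)}$ depends only on the isomorphism class of $\Sigma$, and not on the choice of $f$. -/

import Mathlib

open scoped TensorProduct

universe u v w

noncomputable section

/-- A symmetric composition of dimension 8 over `F`: a triple `(S, n, ⋆)`. -/
structure SymmetricComposition (F : Type u) [Field F] where
  S : Type u
  [addCommGroup : AddCommGroup S]
  [module : Module F S]
  finrank_eq : Module.finrank F S = 8
  n : QuadraticForm F S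
  nondegenerate : (QuadraticMap.polarBilin n).Nondegenerate
  mul : S →ₗ[F] S →ₗ[F] S
  n_mul : ∀ x y, n (mul x y) = n x * n y
  polar_mul : ∀ x y z,
    QuadraticMap.polarBilin n (mul x y) z = QuadraticMap.polarBilin n x (mul y z)

attribute [instance] SymmetricComposition.addCommGroup SymmetricComposition.module

/-- An isomorphism of symmetric compositions. -/
structure SymmetricComposition.Iso {F : Type u} [Field F] (A B : SymmetricComposition F) where
  toEquiv : A.S ≃ₗ[F] B.S
  map_n : ∀ x, B.n (toEquiv x) = A.n x
  map_mul : ∀ x y, toEquiv (A.mul x y) = B.mul (toEquiv x) (toEquiv y)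

/-- A cubic étale `F`-algebra `L` with an `F`-automorphism `ρ` of order 3. -/
structure CyclicCubic (F : Type u) (L : Type v) [Field F] [CommRing L] [Algebra F L] where
  etale : Algebra.Etale F L
  finrank_eq : Module.finrank F L = 3
  ρ : L ≃ₐ[F] L
  orderOf_ρ : orderOf ρ = 3

/-- A cyclic composition `(V, L, Q, ρ, *)` of dimension 8 over `F`. -/
structure CyclicComposition (F : Type u) (L : Type v) (V : Type w) [Field F] [CommRing L]
    [Algebra F L] [AddCommGroup V] [Module F V] [Module L V] [IsScalarTower F L V]
    extends CyclicCubic F L where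
  free : Module.Free L V
  finrank_eq_eight : Module.finrank L V = 8
  Q : QuadraticForm L V
  nondegenerate : (QuadraticMap.polarBilin Q).Nondegenerate
  mul : V →ₗ[F] V →ₗ[F] V
  smul_mul : ∀ (a : L) (x y : V), mul (a • x) y = ρ a • mul x y
  mul_smul : ∀ (a : L) (x y : V), mul x (a • y) = ρ (ρ a) • mul x y
  Q_mul : ∀ x y, Q (mul x y) = ρ (Q x) * ρ (ρ (Q y))
  polar_mul : ∀ x y z, QuadraticMap.polarBilin Q (mul x y) z =
    ρ (QuadraticMap.polarBilin Q (mul y z) x)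
  polar_mul' : ∀ x y z, QuadraticMap.polarBilin Q (mul x y) z =
    ρ (ρ (QuadraticMap.polarBilin Q (mul z x) y))

namespace CyclicComposition

/-- `(ν, f)` is an isotopy `Γ → Γ'`. -/
def IsIsotopy {F L V L' V' : Type*} [Field F] [CommRing L]
    [Algebra F L] [AddCommGroup V] [Module F V] [Module L V] [IsScalarTower F L V]
    [CommRing L'] [Algebra F L'] [AddCommGroup V'] [Module F V'] [Module L' V']
    [IsScalarTower F L' V'] (Γ : CyclicComposition F L V) (Γ' : CyclicComposition F L' V')
    (ν : L ≃ₐ[F] L') (f : V ≃ₗ[F] V') : Prop :=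
  (∀ a, ν (Γ.ρ a) = Γ'.ρ (ν a)) ∧
  (∀ (a : L) (x : V), f (a • x) = ν a • f x) ∧
  ∃ μ : Lˣ,
    (∀ x, Γ'.Q (f x) = ν (Γ.ρ μ * Γ.ρ (Γ.ρ μ) * Γ.Q x)) ∧
    (∀ x y, Γ'.mul (f x) (f y) = ν μ • f (Γ.mul x y))

end CyclicComposition

/-! ### The cyclic composition induced by a symmetric composition -/

namespace SymmetricComposition

section

variable {F : Type u} [Field F] (A : SymmetricComposition F)

theorem polar_symm (x y : A.S) : QuadraticMap.polarBilin A.n x y = QuadraticMap.polarBilin A.n y x := by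
  simp [QuadraticMap.polar_comm]

theorem polar_mul_right (x y z : A.S) : QuadraticMap.polarBilin A.n (A.mul x y) (A.mul x z) = A.n x * QuadraticMap.polarBilin A.n y z := by
  simp only [QuadraticMap.polarBilin_apply_apply, QuadraticMap.polar, ← map_add, A.n_mul]
  ring

theorem polar_mul_four (x y z t : A.S) :
    QuadraticMap.polarBilin A.n (A.mul x y) (A.mul z t) + QuadraticMap.polarBilin A.n (A.mul z y) (A.mul x t) = QuadraticMap.polarBilin A.n x z * QuadraticMap.polarBilin A.n y t := by
  have h := A.polar_mul_right (x + z) y t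
  simp only [map_add, LinearMap.add_apply, A.polar_mul_right] at h
  have h2 : A.n (x + z) = A.n x + A.n z + QuadraticMap.polarBilin A.n x z := by
    simp [QuadraticMap.polar]
  rw [h2] at h
  linear_combination h

variable (L : Type v) [CommRing L] [Algebra F L]

/-- The `L`-bilinear extension of `⋆`. -/
def mulBaseChange : (L ⊗[F] A.S) →ₗ[L] (L ⊗[F] A.S) →ₗ[L] (L ⊗[F] A.S) :=
  LinearMap.BilinMap.baseChange L A.mul

@[simp] theorem mulBaseChange_tmul (a b : L) (x y : A.S) :
    A.mulBaseChange L (a ⊗ₜ x) (b ⊗ₜ y) = (a * b) ⊗ₜ A.mul x y := by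
  simp [mulBaseChange]

variable {L} in
/-- The map `ρ̂ = Id_S ⊗ ρ` (scalars are written on the left). -/
def hatEquiv (ρ : L ≃ₐ[F] L) : (L ⊗[F] A.S) ≃ₗ[F] (L ⊗[F] A.S) :=
  TensorProduct.congr ρ.toLinearEquiv (LinearEquiv.refl F A.S)

variable {L}

@[simp] theorem hatEquiv_tmul (ρ : L ≃ₐ[F] L) (a : L) (x : A.S) :
    A.hatEquiv ρ (a ⊗ₜ x) = ρ a ⊗ₜ x := rfl

theorem hatEquiv_smul (ρ : L ≃ₐ[F] L) (a : L) (x : L ⊗[F] A.S) :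
    A.hatEquiv ρ (a • x) = ρ a • A.hatEquiv ρ x := by
  induction x with
  | zero => simp
  | tmul b s => simp [TensorProduct.smul_tmul']
  | add x y hx hy => simp only [smul_add, map_add, hx, hy]

variable (L)

/-- The polar form over `L`. -/
abbrev polarL : LinearMap.BilinForm L (L ⊗[F] A.S) :=
  LinearMap.BilinForm.baseChange L (QuadraticMap.polarBilin A.n)

theorem polarL_symm (x y : L ⊗[F] A.S) : A.polarL L x y = A.polarL L y x := by
  induction x with
  | zero => simp
  | add x x' hx hx' => simp only [map_add, LinearMap.add_apply, hx, hx']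
  | tmul a s =>
    induction y with
    | zero => simp
    | add x x' hx hx' => simp only [map_add, LinearMap.add_apply, hx, hx']
    | tmul b t => simp [QuadraticMap.polar_comm, mul_comm]

theorem polarL_nondegenerate : (A.polarL L).Nondegenerate := by
  have : FiniteDimensional F A.S := Module.finite_of_finrank_pos (by rw [A.finrank_eq]; norm_num)
  let bs := Module.finBasis F A.S
  let ds := LinearMap.BilinForm.dualBasis (QuadraticMap.polarBilin A.n) A.nondegenerate bs
  have key : ∀ x, (∀ y, A.polarL L x y = 0) → x = 0 := by
    intro x hx
    apply (Module.Basis.baseChange L bs).ext_elem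
    intro i
    have e : ∀ x, A.polarL L (1 ⊗ₜ ds i) x = (Module.Basis.baseChange L bs).repr x i := by
      intro x
      have : A.polarL L (1 ⊗ₜ ds i) = (Module.Basis.baseChange L bs).coord i := by
        apply (Module.Basis.baseChange L bs).ext
        intro j
        have hd := LinearMap.BilinForm.apply_dualBasis_left A.nondegenerate bs i j
        simp only [Module.Basis.baseChange_apply, LinearMap.BilinForm.baseChange_tmul,
          Module.Basis.coord_apply, Module.Basis.baseChange_repr_tmul]
        rw [hd]
        simp [Finsupp.single_apply, eq_comm]
      exact LinearMap.congr_fun this x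
    rw [← e, A.polarL_symm, hx]
    simp
  exact ⟨key, fun y hy => key y fun x => by rw [A.polarL_symm, hy]⟩

theorem polarL_mul (x y z : L ⊗[F] A.S) :
    A.polarL L (A.mulBaseChange L x y) z = A.polarL L x (A.mulBaseChange L y z) := by
  induction x with
  | zero => simp
  | add x x' hx hx' => simp only [map_add, LinearMap.add_apply, hx, hx']
  | tmul a s =>
    induction y with
    | zero => simp
    | add x x' hx hx' => simp only [map_add, LinearMap.add_apply, hx, hx']
    | tmul b t =>
      induction z with
      | zero => simp
      | add x x' hx hx' => simp only [map_add, hx, hx']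
      | tmul c r =>
        simp only [mulBaseChange_tmul, LinearMap.BilinForm.baseChange_tmul, A.polar_mul, mul_assoc]

theorem polarL_mul_four (x y z t : L ⊗[F] A.S) :
    A.polarL L (A.mulBaseChange L x y) (A.mulBaseChange L z t) +
      A.polarL L (A.mulBaseChange L z y) (A.mulBaseChange L x t) =
      A.polarL L x z * A.polarL L y t := by
  induction x with
  | zero => simp
  | add x x' hx hx' =>
    simp only [map_add, LinearMap.add_apply, add_mul] at hx hx' ⊢
    rw [← hx, ← hx']; ring
  | tmul a s =>
  induction y with
  | zero => simp
  | add x x' hx hx' =>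
    simp only [map_add, LinearMap.add_apply, mul_add] at hx hx' ⊢
    rw [← hx, ← hx']; ring
  | tmul b s' =>
  induction z with
  | zero => simp
  | add x x' hx hx' =>
    simp only [map_add, LinearMap.add_apply, add_mul] at hx hx' ⊢
    rw [← hx, ← hx']; ring
  | tmul c r =>
  induction t with
  | zero => simp
  | add x x' hx hx' =>
    simp only [map_add, mul_add] at hx hx' ⊢
    rw [← hx, ← hx']; ring
  | tmul d r' =>
    simp only [mulBaseChange_tmul, LinearMap.BilinForm.baseChange_tmul, Algebra.smul_def]
    have h := congrArg (algebraMap F L) (A.polar_mul_four s s' r r')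
    simp only [map_add, map_mul] at h
    linear_combination (a * b * c * d) * h

variable {L}

theorem hatEquiv_mul (ρ : L ≃ₐ[F] L) (x y : L ⊗[F] A.S) :
    A.hatEquiv ρ (A.mulBaseChange L x y) =
      A.mulBaseChange L (A.hatEquiv ρ x) (A.hatEquiv ρ y) := by
  induction x with
  | zero => simp
  | add x x' hx hx' => simp only [map_add, LinearMap.add_apply, hx, hx']
  | tmul a s =>
    induction y with
    | zero => simp
    | add x x' hx hx' => simp only [map_add, hx, hx']
    | tmul b t => simp

theorem polarL_hat (ρ : L ≃ₐ[F] L) (x y : L ⊗[F] A.S) :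
    A.polarL L (A.hatEquiv ρ x) (A.hatEquiv ρ y) = ρ (A.polarL L x y) := by
  induction x with
  | zero => simp
  | add x x' hx hx' => simp only [map_add, LinearMap.add_apply, hx, hx']
  | tmul a s =>
    induction y with
    | zero => simp
    | add x x' hx hx' => simp only [map_add, hx, hx']
    | tmul b t => simp

theorem hatEquiv_cube (K : CyclicCubic F L) (x : L ⊗[F] A.S) :
    A.hatEquiv K.ρ (A.hatEquiv K.ρ (A.hatEquiv K.ρ x)) = x := by
  have h : ∀ a, K.ρ (K.ρ (K.ρ a)) = a := fun a => by
    have := pow_orderOf_eq_one K.ρ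
    rw [K.orderOf_ρ] at this
    exact DFunLike.congr_fun this a
  induction x with
  | zero => simp
  | add x x' hx hx' => simp only [map_add, hx, hx']
  | tmul a s => simp [h]

variable [NeZero (2 : F)]

variable (L) in
/-- The scalar extension `n_L` of the norm to `L`. -/
def normL : QuadraticForm L (L ⊗[F] A.S) :=
  letI : Invertible (2 : F) := invertibleOfNonzero (NeZero.ne 2)
  QuadraticForm.baseChange L A.n

theorem polarBilin_normL : QuadraticMap.polarBilin (A.normL L) = A.polarL L := by
  let _ : Invertible (2 : F) := invertibleOfNonzero (NeZero.ne 2)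
  let _ : Invertible (2 : L) := (Invertible.map (algebraMap F L) 2).copy 2 (map_ofNat _ _).symm
  exact QuadraticForm.polarBilin_baseChange A.n

theorem two_mul_normL (x : L ⊗[F] A.S) : 2 * A.normL L x = A.polarL L x x := by
  rw [← polarBilin_normL]
  simp [QuadraticMap.polar_self]

theorem isUnit_two {F : Type u} {L : Type v} [Field F] [CommRing L] [Algebra F L] [NeZero (2 : F)] :
    IsUnit (2 : L) := by
  have : IsUnit (2 : F) := (NeZero.ne (2 : F)).isUnit
  have h := this.map (algebraMap F L)
  rwa [map_ofNat] at h

theorem normL_hat (ρ : L ≃ₐ[F] L) (x : L ⊗[F] A.S) :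
    A.normL L (A.hatEquiv ρ x) = ρ (A.normL L x) := by
  apply (isUnit_two (F := F) (L := L)).mul_left_cancel
  rw [two_mul_normL, polarL_hat, ← two_mul_normL, map_mul, map_ofNat]

theorem normL_mul (x y : L ⊗[F] A.S) :
    A.normL L (A.mulBaseChange L x y) = A.normL L x * A.normL L y := by
  have h2 := isUnit_two (F := F) (L := L)
  apply (h2.mul h2).mul_left_cancel
  have h := A.polarL_mul_four L x y x y
  simp only [← two_mul_normL] at h
  linear_combination h

/-- The cyclic composition `Σ ⊗ (L, ρ) = (S ⊗ L, L, n_L, ρ, *)` where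
`x * y = ρ̂ x ⋆ ρ̂² y`. -/
def inducedCyclic (K : CyclicCubic F L) : CyclicComposition F L (L ⊗[F] A.S) where
  toCyclicCubic := K
  free := inferInstance
  finrank_eq_eight := by
    have : Nontrivial L := by
      by_contra h
      rw [not_nontrivial_iff_subsingleton] at h
      have := K.finrank_eq
      rw [Module.finrank_zero_of_subsingleton] at this
      omega
    rw [Module.finrank_baseChange, A.finrank_eq]
  Q := A.normL L
  nondegenerate := by rw [polarBilin_normL]; exact A.polarL_nondegenerate L
  mul := LinearMap.mk₂ F
    (fun x y => A.mulBaseChange L (A.hatEquiv K.ρ x) (A.hatEquiv K.ρ (A.hatEquiv K.ρ y)))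
    (by intros; simp) (by intros; simp [LinearMap.map_smul_of_tower])
    (by intros; simp) (by intros; simp [LinearMap.map_smul_of_tower])
  smul_mul a x y := by simp [hatEquiv_smul]
  mul_smul a x y := by simp [hatEquiv_smul]
  Q_mul x y := by simp [normL_mul, normL_hat]
  polar_mul x y z := by
    simp only [polarBilin_normL, LinearMap.mk₂_apply]
    rw [← polarL_hat, hatEquiv_mul, hatEquiv_cube, polarL_mul]
    exact A.polarL_symm L _ _
  polar_mul' x y z := by
    simp only [polarBilin_normL, LinearMap.mk₂_apply]
    have h : A.hatEquiv K.ρ (A.hatEquiv K.ρ (A.mulBaseChange L (A.hatEquiv K.ρ z)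
        (A.hatEquiv K.ρ (A.hatEquiv K.ρ x)))) = A.mulBaseChange L z (A.hatEquiv K.ρ x) := by
      simp only [hatEquiv_mul, hatEquiv_cube]
    rw [← polarL_hat, ← polarL_hat, h, A.polarL_mul L z]
    exact A.polarL_symm L _ _

end

end SymmetricComposition

/-! ### Twisted modules -/

/-- The twisted module `^ν V`, with elements `^ν x` for `x ∈ V` and `^ν (a x) = ν(a) (^ν x)`. -/
def Twist {F : Type u} {L : Type v} [Field F] [Field L] [Algebra F L] (_ν : L ≃ₐ[F] L)
    (V : Type w) : Type w := V

namespace Twist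

section

variable {F : Type u} {L : Type v} {V : Type w} [Field F] [Field L] [Algebra F L]
  (ν : L ≃ₐ[F] L) [AddCommGroup V] [Module L V]

instance : AddCommGroup (Twist ν V) := inferInstanceAs (AddCommGroup V)

instance : Module L (Twist ν V) := Module.compHom V (ν.symm : L →+* L)

/-- The map `x ↦ ^ν x`. -/
def of : V ≃+ Twist ν V := AddEquiv.refl V

theorem of_smul (a : L) (x : V) : of ν (a • x) = ν a • of ν x := by
  change a • x = ν.symm (ν a) • x
  rw [ν.symm_apply_apply]

theorem of_symm_smul (a : L) (x : Twist ν V) :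
    (of ν).symm (a • x) = ν.symm a • (of ν).symm x := rfl

variable (V)

/-- The identification `f ↦ ^ν f` of `^ν (End_L V)` with `End_L (^ν V)`, where
`^ν f (^ν x) = ^ν (f x)`. -/
def endEquiv : Module.End L V ≃+* Module.End L (Twist ν V) where
  toFun f :=
    { toFun := fun x => of ν (f ((of ν).symm x))
      map_add' := fun x y => by simp
      map_smul' := fun a x => by simp [of_symm_smul, of_smul] }
  invFun g :=
    { toFun := fun x => (of ν).symm (g (of ν x))
      map_add' := fun x y => by simp
      map_smul' := fun a x => by simp [of_symm_smul, of_smul] }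
  left_inv f := by ext; simp
  right_inv g := by ext; simp
  map_mul' f g := by ext; simp
  map_add' f g := by ext; simp

variable {V}

/-- The automorphism `^ν φ : ^ν f ↦ ^ν (φ f)`. -/
def endMap (φ : Module.End L V ≃+* Module.End L V) :
    Module.End L (Twist ν V) ≃+* Module.End L (Twist ν V) :=
  ((endEquiv V ν).symm.trans φ).trans (endEquiv V ν)

end

end Twist

/-! ### The trialitarian algebra `End Γ` and its automorphisms -/

namespace CyclicComposition

section

variable {F : Type u} {L : Type v} {V : Type w} [Field F] [Field L] [Algebra F L]
  [AddCommGroup V] [Module F V] [Module L V] [IsScalarTower F L V]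
  (Γ : CyclicComposition F L V)

/-- The automorphism `θ = ρ²`. -/
def θ : L ≃ₐ[F] L := Γ.ρ ^ 2

theorem θ_apply (a : L) : Γ.θ a = Γ.ρ (Γ.ρ a) := rfl

theorem ρ_cube (a : L) : Γ.ρ (Γ.ρ (Γ.ρ a)) = a := by
  have := pow_orderOf_eq_one Γ.ρ
  rw [Γ.orderOf_ρ] at this
  exact DFunLike.congr_fun this a

theorem polar_symm (x y : V) :
    QuadraticMap.polarBilin Γ.Q x y = QuadraticMap.polarBilin Γ.Q y x := by
  simp [QuadraticMap.polar_comm]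

theorem polar_mul_left (x z t : V) :
    QuadraticMap.polarBilin Γ.Q (Γ.mul x z) (Γ.mul x t) =
      Γ.ρ (Γ.Q x) * Γ.ρ (Γ.ρ (QuadraticMap.polarBilin Γ.Q z t)) := by
  simp only [QuadraticMap.polarBilin_apply_apply, QuadraticMap.polar, ← map_add, Γ.Q_mul]
  simp only [map_sub]
  ring

theorem polar_mul_right (x z t : V) :
    QuadraticMap.polarBilin Γ.Q (Γ.mul z x) (Γ.mul t x) =
      Γ.ρ (QuadraticMap.polarBilin Γ.Q z t) * Γ.ρ (Γ.ρ (Γ.Q x)) := by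
  simp only [QuadraticMap.polarBilin_apply_apply, QuadraticMap.polar, ← map_add,
    ← LinearMap.add_apply, Γ.Q_mul]
  simp only [map_sub]
  ring

theorem mul_mul_self (x y : V) : Γ.mul (Γ.mul x y) x = Γ.θ (Γ.Q x) • y := by
  rw [← sub_eq_zero]
  apply Γ.nondegenerate.1
  intro z
  rw [map_sub, LinearMap.sub_apply, Γ.polar_mul, Γ.polar_symm, Γ.polar_mul_left, map_smul,
    LinearMap.smul_apply, map_mul, Γ.ρ_cube, Γ.polar_symm, smul_eq_mul, θ_apply, sub_self]

theorem self_mul_mul (x y : V) : Γ.mul x (Γ.mul y x) = Γ.ρ (Γ.Q x) • y := by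
  rw [← sub_eq_zero]
  apply Γ.nondegenerate.1
  intro z
  rw [map_sub, LinearMap.sub_apply, Γ.polar_mul', Γ.polar_mul_right, map_smul,
    LinearMap.smul_apply, map_mul, map_mul, Γ.ρ_cube, Γ.ρ_cube, Γ.polar_symm, smul_eq_mul,
    mul_comm, sub_self]

/-- `ℓ_x : ^ρ V → ^θ V`, `^ρ y ↦ ^θ (x * y)`. -/
def leftMap (x : V) : Twist Γ.ρ V →ₗ[L] Twist Γ.θ V where
  toFun y := Twist.of Γ.θ (Γ.mul x ((Twist.of Γ.ρ).symm y))
  map_add' := by simp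
  map_smul' a y := by
    simp [Twist.of_symm_smul, Γ.mul_smul, Twist.of_smul, θ_apply, Γ.ρ_cube]

/-- `r_x : ^θ V → ^ρ V`, `^θ z ↦ ^ρ (z * x)`. -/
def rightMap (x : V) : Twist Γ.θ V →ₗ[L] Twist Γ.ρ V where
  toFun z := Twist.of Γ.ρ (Γ.mul ((Twist.of Γ.θ).symm z) x)
  map_add' := by simp
  map_smul' a y := by
    simp only [Twist.of_symm_smul, Γ.smul_mul, Twist.of_smul, RingHom.id_apply, ← θ_apply,
      AlgEquiv.apply_symm_apply]

/-- The `L`-linear map `x ↦ ((0, r_x), (ℓ_x, 0))` from `V` to `End_L (^ρ V ⊕ ^θ V)`. -/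
def alphaLin : V →ₗ[L] Module.End L (Twist Γ.ρ V × Twist Γ.θ V) where
  toFun x := ((Γ.rightMap x).comp (LinearMap.snd L _ _)).prod
    ((Γ.leftMap x).comp (LinearMap.fst L _ _))
  map_add' x y := by
    ext <;> simp [leftMap, rightMap]
  map_smul' a x := by
    ext <;> simp [leftMap, rightMap, Γ.smul_mul, Γ.mul_smul, Twist.of_smul, θ_apply, Γ.ρ_cube]

theorem alphaLin_sq (x : V) : Γ.alphaLin x * Γ.alphaLin x =
    algebraMap L (Module.End L (Twist Γ.ρ V × Twist Γ.θ V)) (Γ.Q x) := by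
  ext <;> simp [alphaLin, leftMap, rightMap, mul_mul_self, self_mul_mul, Twist.of_smul, θ_apply,
    Γ.ρ_cube]

/-- The homomorphism `α_* : C(V, Q) → End_L (^ρ V ⊕ ^θ V)`. -/
def alpha : CliffordAlgebra Γ.Q →ₐ[L] Module.End L (Twist Γ.ρ V × Twist Γ.θ V) :=
  CliffordAlgebra.lift Γ.Q ⟨Γ.alphaLin, Γ.alphaLin_sq⟩

/-- Block-diagonal endomorphisms of `^ρ V ⊕ ^θ V`. -/
def blockDiag : Module.End L (Twist Γ.ρ V) × Module.End L (Twist Γ.θ V) →ₐ[L]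
    Module.End L (Twist Γ.ρ V × Twist Γ.θ V) where
  toFun g := g.1.prodMap g.2
  map_one' := by ext <;> simp
  map_mul' _ _ := by ext <;> simp
  map_zero' := by ext <;> simp
  map_add' _ _ := by ext <;> simp
  commutes' a := by ext <;> simp [Module.algebraMap_end_apply]

theorem blockDiag_injective : Function.Injective Γ.blockDiag := by
  intro g h e
  refine Prod.ext (LinearMap.ext fun x => ?_) (LinearMap.ext fun x => ?_)
  · exact congrArg Prod.fst (LinearMap.congr_fun e (x, 0))
  · exact congrArg Prod.snd (LinearMap.congr_fun e (0, x))

/-- The pair `(r_x ℓ_y, ℓ_x r_y)` of diagonal blocks of `α_*(x) α_*(y)`. -/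
def alphaPair (x y : V) : Module.End L (Twist Γ.ρ V) × Module.End L (Twist Γ.θ V) :=
  (Γ.rightMap x ∘ₗ Γ.leftMap y, Γ.leftMap x ∘ₗ Γ.rightMap y)

theorem blockDiag_alphaPair (x y : V) :
    Γ.blockDiag (Γ.alphaPair x y) = Γ.alphaLin x * Γ.alphaLin y := by
  ext <;> simp [blockDiag, alphaPair, alphaLin]

/-- The homomorphism `α_{*0} : C_0(V, Q) → End_L (^ρ V) × End_L (^θ V)`; on products it is given by
`x y ↦ (r_x ℓ_y, ℓ_x r_y)`. It is the restriction of `α_*`, see `blockDiag_alphaEven`. -/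
def alphaEven : CliffordAlgebra.even Γ.Q →ₐ[L]
    Module.End L (Twist Γ.ρ V) × Module.End L (Twist Γ.θ V) :=
  CliffordAlgebra.even.lift Γ.Q
    { bilin := LinearMap.mk₂ L Γ.alphaPair
        (fun x x' y => Γ.blockDiag_injective (by simp only [map_add, blockDiag_alphaPair, add_mul]))
        (fun a x y => Γ.blockDiag_injective (by
          simp only [map_smul, blockDiag_alphaPair, smul_mul_assoc]))
        (fun x y y' => Γ.blockDiag_injective (by simp only [map_add, blockDiag_alphaPair, mul_add]))
        (fun a x y => Γ.blockDiag_injective (by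
          simp only [map_smul, blockDiag_alphaPair, mul_smul_comm]))
      contract := fun x => Γ.blockDiag_injective (by
        rw [LinearMap.mk₂_apply, blockDiag_alphaPair, alphaLin_sq, AlgHom.commutes])
      contract_mid := fun x y z => Γ.blockDiag_injective (by
        simp only [LinearMap.mk₂_apply, map_mul, map_smul, blockDiag_alphaPair]
        rw [mul_assoc, ← mul_assoc (Γ.alphaLin y), alphaLin_sq, ← Algebra.smul_def,
          mul_smul_comm]) }

theorem blockDiag_alphaEven (c : CliffordAlgebra.even Γ.Q) :
    Γ.blockDiag (Γ.alphaEven c) = Γ.alpha c := by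
  have h : Γ.blockDiag.comp Γ.alphaEven = Γ.alpha.comp (CliffordAlgebra.even Γ.Q).val := by
    apply CliffordAlgebra.even.algHom_ext
    apply CliffordAlgebra.EvenHom.ext
    ext1 x
    ext1 y
    change Γ.blockDiag (Γ.alphaEven ((CliffordAlgebra.even.ι Γ.Q).bilin x y)) =
      Γ.alpha (CliffordAlgebra.ι Γ.Q x * CliffordAlgebra.ι Γ.Q y)
    rw [alphaEven, CliffordAlgebra.even.lift_ι, LinearMap.mk₂_apply, blockDiag_alphaPair, alpha,
      map_mul, CliffordAlgebra.lift_ι_apply, CliffordAlgebra.lift_ι_apply]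
  exact DFunLike.congr_fun h c

/-- The canonical map `End_L V → C(End_L V, σ_Q) = C_0(V, Q)`: with `x ⊗ y` denoting the
endomorphism `z ↦ x b_Q(y, z)`, it is the linear map such that `x ⊗ y ↦ x y`. -/
def canonicalMap : Module.End L V →ₗ[L] CliffordAlgebra.even Γ.Q :=
  haveI : Module.Free L V := Γ.free
  haveI : FiniteDimensional L V :=
    Module.finite_of_finrank_pos (by rw [Γ.finrank_eq_eight]; norm_num)
  (TensorProduct.lift (CliffordAlgebra.even.ι Γ.Q).bilin.flip) ∘ₗ
    (TensorProduct.congr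
      (LinearMap.BilinForm.toDual (QuadraticMap.polarBilin Γ.Q) Γ.nondegenerate)
      (LinearEquiv.refl L V) ≪≫ₗ dualTensorHomEquiv L V V).symm.toLinearMap

theorem canonicalMap_apply (x y : V) :
    Γ.canonicalMap ((QuadraticMap.polarBilin Γ.Q y).smulRight x) =
      (CliffordAlgebra.even.ι Γ.Q).bilin x y := by
  have : Module.Free L V := Γ.free
  have : FiniteDimensional L V :=
    Module.finite_of_finrank_pos (by rw [Γ.finrank_eq_eight]; norm_num)
  have h : (QuadraticMap.polarBilin Γ.Q y).smulRight x = (TensorProduct.congr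
      (LinearMap.BilinForm.toDual (QuadraticMap.polarBilin Γ.Q) Γ.nondegenerate)
      (LinearEquiv.refl L V) ≪≫ₗ dualTensorHomEquiv L V V) (y ⊗ₜ x) := by
    ext z
    simp [dualTensorHomEquiv, LinearMap.BilinForm.toDual_def]
  rw [h]
  simp only [canonicalMap, LinearMap.comp_apply, LinearEquiv.coe_coe,
    LinearEquiv.symm_apply_apply, TensorProduct.lift.tmul, LinearMap.flip_apply]

/-- The involution `σ_Q` of `End_L V` adjoint to `Q`. -/
def adjointInvolution (g : Module.End L V) : Module.End L V :=
  haveI : FiniteDimensional L V :=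
    Module.finite_of_finrank_pos (by rw [Γ.finrank_eq_eight]; norm_num)
  LinearMap.BilinForm.leftAdjointOfNondegenerate (QuadraticMap.polarBilin Γ.Q) Γ.nondegenerate g

/-- `φ` is an automorphism of the trialitarian algebra `End Γ = (End_L V, L, σ_Q, α_{*0})`:
an automorphism of `F`-algebras with involution, whose restriction to the center `L` commutes
with `ρ`, and such that `(^ρ φ × ^θ φ) ∘ α_{*0} = α_{*0} ∘ C(φ)`. Here `C(φ)` is the ring
automorphism of `C(End_L V, σ_Q)` induced by `φ`, that is, the one compatible with the
canonical map from `End_L V`. -/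
def IsTrialitarianAut (φ : Module.End L V ≃ₐ[F] Module.End L V) : Prop :=
  (∀ g, φ (Γ.adjointInvolution g) = Γ.adjointInvolution (φ g)) ∧
  (∃ ν : L ≃ₐ[F] L, (∀ a, ν (Γ.ρ a) = Γ.ρ (ν a)) ∧
    ∀ a, φ (algebraMap L _ a) = algebraMap L _ (ν a)) ∧
  ∃ C : CliffordAlgebra.even Γ.Q ≃+* CliffordAlgebra.even Γ.Q,
    (∀ g, C (Γ.canonicalMap g) = Γ.canonicalMap (φ g)) ∧
    ∀ c, Γ.alphaEven (C c) =
      (Twist.endMap Γ.ρ φ.toRingEquiv (Γ.alphaEven c).1,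
        Twist.endMap Γ.θ φ.toRingEquiv (Γ.alphaEven c).2)

/-- The group `Aut_F (End Γ)`. -/
def autEnd : Subgroup (Module.End L V ≃ₐ[F] Module.End L V) where
  carrier := {φ | Γ.IsTrialitarianAut φ}
  one_mem' := by
    refine ⟨fun g => rfl, ⟨AlgEquiv.refl, fun a => rfl, fun a => rfl⟩, RingEquiv.refl _,
      fun g => rfl, fun c => ?_⟩
    ext <;> rfl
  mul_mem' := by
    rintro φ ψ ⟨h1, ⟨ν, h2, h3⟩, C, h4, h5⟩ ⟨k1, ⟨ν', k2, k3⟩, D, k4, k5⟩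
    refine ⟨fun g => ?_, ⟨ν'.trans ν, fun a => ?_, fun a => ?_⟩, D.trans C, fun g => ?_,
      fun c => ?_⟩
    · simp only [AlgEquiv.mul_apply, k1, h1]
    · simp only [AlgEquiv.trans_apply, k2, h2]
    · simp only [AlgEquiv.mul_apply, AlgEquiv.trans_apply, k3, h3]
    · simp only [AlgEquiv.mul_apply, RingEquiv.trans_apply, k4, h4]
    · simp only [RingEquiv.trans_apply, h5, k5]
      ext <;> simp [Twist.endMap]
  inv_mem' := by
    rintro φ ⟨h1, ⟨ν, h2, h3⟩, C, h4, h5⟩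
    have hφ : ∀ g, φ (φ⁻¹ g) = g := fun g => φ.apply_symm_apply g
    refine ⟨fun g => ?_, ⟨ν.symm, fun a => ?_, fun a => ?_⟩, C.symm, fun g => ?_, fun c => ?_⟩
    · apply φ.injective
      rw [h1, hφ, hφ]
    · apply ν.injective
      rw [h2, ν.apply_symm_apply, ν.apply_symm_apply]
    · apply φ.injective
      rw [h3, hφ, ν.apply_symm_apply]
    · apply C.injective
      rw [h4, hφ, C.apply_symm_apply]
    · have h := h5 (C.symm c)
      rw [C.apply_symm_apply] at h
      rw [h]
      ext <;> simp [Twist.endMap]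

/-- The set of conjugacy classes in `Aut_F (End Γ)` of automorphisms `τ` such that `τ³ = Id` and
`τ|_L = ρ`. -/
def trialityClasses : Set (ConjClasses Γ.autEnd) :=
  {c | ∃ τ : Γ.autEnd, ConjClasses.mk τ = c ∧ τ ^ 3 = 1 ∧
    ∀ a : L, (τ : Module.End L V ≃ₐ[F] Module.End L V) (algebraMap L _ a) =
      algebraMap L _ (Γ.ρ a)}

/-- The automorphism `Int(t)|_{End_L V} : g ↦ t ∘ g ∘ t⁻¹` of `End_L V`, for a `ν`-semilinear
bijection `t`. -/
def semilinearInt (ν : L ≃ₐ[F] L) (t : V ≃ₗ[F] V) (ht : ∀ (a : L) (x : V), t (a • x) = ν a • t x) :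
    Module.End L V ≃ₐ[F] Module.End L V :=
  have ht' : ∀ (a : L) (x : V), t.symm (a • x) = ν.symm a • t.symm x := fun a x => by
    apply t.injective
    simp [ht]
  { toFun := fun g =>
      { toFun := fun x => t (g (t.symm x))
        map_add' := fun x y => by simp
        map_smul' := fun a x => by simp [ht, ht'] }
    invFun := fun g =>
      { toFun := fun x => t.symm (g (t x))
        map_add' := fun x y => by simp
        map_smul' := fun a x => by simp [ht, ht'] }
    left_inv := fun g => by ext; simp
    right_inv := fun g => by ext; simp
    map_mul' := fun g h => by ext; simp
    map_add' := fun g h => by ext; simp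
    commutes' := fun a => by ext; simp [Module.algebraMap_end_apply] }

variable [NeZero (2 : F)]

/-- `f : Σ ⊗ (L, ρ) → Γ` is an `L`-linear isotopy. -/
def IsLinearIsotopy (A : SymmetricComposition F) (f : (L ⊗[F] A.S) ≃ₗ[L] V) : Prop :=
  IsIsotopy (A.inducedCyclic Γ.toCyclicCubic) Γ AlgEquiv.refl (f.restrictScalars F)

/-- The automorphism `τ_{(Σ, f)} = Int(f ∘ ρ̂ ∘ f⁻¹)|_{End_L V}`. -/
def tau (A : SymmetricComposition F) (f : (L ⊗[F] A.S) ≃ₗ[L] V) :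
    Module.End L V ≃ₐ[F] Module.End L V :=
  semilinearInt Γ.ρ
    (((f.restrictScalars F).symm.trans (A.hatEquiv Γ.ρ)).trans (f.restrictScalars F))
    (fun a x => by
      change f (A.hatEquiv Γ.ρ (f.symm (a • x))) = Γ.ρ a • f (A.hatEquiv Γ.ρ (f.symm x))
      rw [map_smul, SymmetricComposition.hatEquiv_smul, map_smul])

/-- The symmetric compositions `Σ` for which there is an `L`-linear isotopy
`Σ ⊗ (L, ρ) → Γ`. -/
def Inducing : Type (u + 1) :=
  {A : SymmetricComposition F // ∃ f : (L ⊗[F] A.S) ≃ₗ[L] V, Γ.IsLinearIsotopy A f}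

/-- Isomorphism of symmetric compositions, as an equivalence relation. -/
instance inducingSetoid : Setoid Γ.Inducing where
  r A B := Nonempty (A.1.Iso B.1)
  iseqv :=
    { refl := fun A => ⟨⟨LinearEquiv.refl F _, fun _ => rfl, fun _ _ => rfl⟩⟩
      symm := by
        rintro A B ⟨e, h1, h2⟩
        exact ⟨e.symm, fun x => by rw [← h1, e.apply_symm_apply], fun x y => by
          apply e.injective
          rw [h2, e.apply_symm_apply, e.apply_symm_apply, e.apply_symm_apply]⟩
      trans := by
        rintro A B D ⟨e, h1, h2⟩ ⟨e', k1, k2⟩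
        exact ⟨e.trans e', fun x => by simp [h1, k1], fun x y => by simp [h2, k2]⟩ }

/-- The isomorphism classes of symmetric compositions `Σ` for which there is an `L`-linear
isotopy `Σ ⊗ (L, ρ) → Γ`. -/
def InducingClasses : Type (u + 1) := Quotient Γ.inducingSetoid

/-- The isomorphism class of `Σ`. -/
def inducingClass (A : SymmetricComposition F) (f : (L ⊗[F] A.S) ≃ₗ[L] V)
    (hf : Γ.IsLinearIsotopy A f) : Γ.InducingClasses :=
  Quotient.mk Γ.inducingSetoid ⟨A, f, hf⟩

end

end CyclicComposition

end

/-! The automorphisms of End Γ are exactly the maps Int g with g a semilinear isotopy of Γ with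
itself (`IsIsotopy.semilinearInt_mem`, `exists_isIsotopy_of_mem_autEnd`), and Int g determines g up
to a factor in L^×. Conjugacy of automorphisms thus becomes conjugacy of semilinear maps up to
scalars, and the theorem becomes Galois descent along L/F.

The hard half is to recover an isotopy from an automorphism φ. A Skolem–Noether argument gives φ =
Int g; commutation with σ_Q makes g a similitude; compatibility with α_{*0} says that g respects the
ternary products (y*z)*x and x*(z*y) up to scalars. Rewriting one factor of x*y as a product with a
fixed anisotropic vector then gives g(x*y) = k(gx)*gy = gx*K(gy) with k, K linear. The rigidity
lemma `exists_smul_of_mul_eq_mul` forces k to be a scalar, so g is an isotopy. Rigidity follows from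
the identities (x*y)*x = ρ²(Q(x))y and x*(y*x) = ρ(Q(x))y, together with enough room in dimension 8
to choose three suitably orthogonal vectors, and 2 ≠ 0.

Surjectivity: if τ = Int t has τ³ = 1 and τ|_L = ρ, then t³ is a scalar, equal to the norm of the
multiplier μ of t, so μ⁻¹t has cube 1. Its fixed points form an F-structure on V, and a suitable
norm-one factor η makes η(x*y) a symmetric composition there (`exists_rescale_cube_eq_one`,
`exists_symmetricComposition`).

Injectivity: a conjugating isotopy g intertwines the two maps f∘ρ̂∘f⁻¹ up to a scalar c of norm 1.
Hilbert 90 removes c after rescaling g, which then carries fixed points to fixed points and is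
multiplicative up to a scalar of F^×; a last rescaling gives an isomorphism
(`nonempty_iso_of_mk_tau_eq`). -/

namespace CyclicComposition

/-! ### Rigidity: linear maps that can be moved across the product are scalars. -/

section Rigidity

theorem two_ne_zero_of_algebra (F L : Type*) [Field F] [Field L] [Algebra F L] [NeZero (2 : F)] :
    (2 : L) ≠ 0 :=
  (SymmetricComposition.isUnit_two (F := F) (L := L)).ne_zero

variable {F : Type u} {L : Type v} {V : Type w} [Field F] [Field L] [Algebra F L]
  [AddCommGroup V] [Module F V] [Module L V] [IsScalarTower F L V]
  (Γ : CyclicComposition F L V)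

/-- The polar form of `Q`. -/
abbrev polarForm : LinearMap.BilinForm L V := QuadraticMap.polarBilin Γ.Q

include Γ in
theorem finiteDimensional : FiniteDimensional L V :=
  Module.finite_of_finrank_pos (by rw [Γ.finrank_eq_eight]; norm_num)

theorem Q_add (x y : V) : Γ.Q (x + y) = Γ.Q x + Γ.Q y + Γ.polarForm x y := by
  simp [QuadraticMap.polar]

theorem polarForm_self (x : V) : Γ.polarForm x x = 2 * Γ.Q x := by
  simp [QuadraticMap.polar_self]

/-- Linearization in x of (x*y)*x = ρ²(Q(x))y; for orthogonal x, z the outer factors anticommute. -/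
theorem mul_mul_add (x y z : V) :
    Γ.mul (Γ.mul x y) z + Γ.mul (Γ.mul z y) x = Γ.ρ (Γ.ρ (Γ.polarForm x z)) • y := by
  have h := Γ.mul_mul_self (x + z) y
  rw [Q_add] at h
  simp only [map_add, LinearMap.add_apply, add_smul, mul_mul_self, θ_apply] at h ⊢
  have h' := congrArg (fun t => t - (Γ.ρ (Γ.ρ (Γ.Q x)) • y + Γ.ρ (Γ.ρ (Γ.Q z)) • y)) h
  convert h' using 1 <;> abel

theorem mul_add_mul (x y z : V) :
    Γ.mul x (Γ.mul y z) + Γ.mul z (Γ.mul y x) = Γ.ρ (Γ.polarForm x z) • y := by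
  have h := Γ.self_mul_mul (x + z) y
  rw [Q_add] at h
  simp only [map_add, LinearMap.add_apply, add_smul, self_mul_mul] at h ⊢
  have h' := congrArg (fun t => t - (Γ.ρ (Γ.Q x) • y + Γ.ρ (Γ.Q z) • y)) h
  convert h' using 1 <;> abel

theorem mul_left_surjective {x : V} (hx : Γ.Q x ≠ 0) (y : V) : ∃ z, Γ.mul x z = y :=
  ⟨Γ.mul ((Γ.ρ (Γ.Q x))⁻¹ • y) x, by
    rw [Γ.self_mul_mul, smul_smul, mul_inv_cancel₀ (by simpa using hx), one_smul]⟩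

theorem eq_zero_of_mul_left {x z : V} (hx : Γ.Q x ≠ 0) (h : Γ.mul x z = 0) : z = 0 := by
  have h1 := Γ.mul_mul_self x z
  rw [h, map_zero, LinearMap.zero_apply] at h1
  exact (smul_eq_zero.1 h1.symm).resolve_left (by simpa [θ_apply] using hx)

/-- If U^⊥ were totally singular it would lie in U^⊥⊥ = U. As dim U^⊥ ≥ 4 ≥ dim U, this forces U =
U^⊥, so that Q(u) = 0. -/
theorem exists_orthogonal_Q_ne_zero (U : Submodule L V) (hU : Module.finrank L U ≤ 4) {u : V}
    (hu : u ∈ U) (hQ : Γ.Q u ≠ 0) : ∃ w, Γ.Q w ≠ 0 ∧ ∀ x ∈ U, Γ.polarForm x w = 0 := by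
  have := Γ.finiteDimensional
  by_contra! h
  have hrefl : Γ.polarForm.IsRefl := fun x y hxy => by rw [← hxy]; exact Γ.polar_symm y x
  have hW : ∀ w ∈ Γ.polarForm.orthogonal U, Γ.Q w = 0 := fun w hw => by
    by_contra hne
    obtain ⟨x, hx, hxw⟩ := h w hne
    exact hxw (LinearMap.BilinForm.mem_orthogonal_iff.1 hw x hx)
  have hle : Γ.polarForm.orthogonal U ≤
      Γ.polarForm.orthogonal (Γ.polarForm.orthogonal U) := by
    intro w hw
    rw [LinearMap.BilinForm.mem_orthogonal_iff]
    intro y hy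
    have h1 := Γ.Q_add y w
    rw [hW _ hw, hW _ hy, hW _ (add_mem hy hw)] at h1
    change Γ.polarForm y w = 0
    simpa using h1.symm
  rw [LinearMap.BilinForm.orthogonal_orthogonal Γ.nondegenerate hrefl U] at hle
  have hfin := LinearMap.BilinForm.finrank_orthogonal Γ.nondegenerate U
  have hUle := Submodule.finrank_le U
  rw [Γ.finrank_eq_eight] at hfin hUle
  have heq := Submodule.eq_of_le_of_finrank_le hle (by rw [hfin]; omega)
  exact hQ (hW u (by rwa [heq]))

theorem exists_Q_ne_zero : ∃ x, Γ.Q x ≠ 0 := by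
  by_contra! h
  have := Γ.finiteDimensional
  have : Nontrivial V := Module.nontrivial_of_finrank_pos (R := L)
    (by rw [Γ.finrank_eq_eight]; norm_num)
  obtain ⟨x, hx⟩ := exists_ne (0 : V)
  refine hx (Γ.nondegenerate.1 x fun y => ?_)
  simp [QuadraticMap.polar, h]

variable [NeZero (2 : F)]

/-- Anisotropic vectors span: if Q(v) = 0 and Q(y) ≠ 0, then Q(y+v) + Q(y-v) = 2Q(y) ≠ 0, so one of
y ± v is anisotropic along with y. -/
theorem linearMap_ext_of_Q_ne_zero {k k' : V →ₗ[F] V}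
    (h : ∀ x, Γ.Q x ≠ 0 → k x = k' x) : k = k' := by
  ext v
  obtain ⟨y, hy⟩ := Γ.exists_Q_ne_zero
  by_cases hv : Γ.Q v = 0
  · by_cases h1 : Γ.Q (y + v) = 0
    · have h2 : Γ.Q (y - v) ≠ 0 := fun h2 => by
        rw [Q_add, hv] at h1
        rw [sub_eq_add_neg, Q_add, QuadraticMap.map_neg, map_neg, hv] at h2
        have h3 : 2 * Γ.Q y = 0 := by linear_combination h1 + h2
        exact (mul_ne_zero (two_ne_zero_of_algebra F L) hy) h3
      have h3 := h _ h2
      rw [map_sub, map_sub, h y hy] at h3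
      simpa using h3
    · have h3 := h _ h1
      rw [map_add, map_add, h y hy] at h3
      simpa using h3
  · exact h v hv

/-- A skew-symmetric `k` with `k x * y = x * K y` for some `K` is zero. -/
theorem eq_zero_of_skew (k K : Module.End L V) (h : ∀ x y, Γ.mul (k x) y = Γ.mul x (K y))
    (hk : ∀ x, Γ.polarForm (k x) x = 0) : k = 0 := by
  have key1 : ∀ x w v, Γ.polarForm x w = 0 → Γ.polarForm (k x) w = 0 →
      Γ.mul x (Γ.mul (Γ.mul w v) (k x)) = Γ.ρ (Γ.Q x) • Γ.mul (k w) v := by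
    intro x w v hx hkx
    have e1 := Γ.mul_mul_add (k x) v w
    rw [hkx, map_zero, map_zero, zero_smul] at e1
    have e2 := Γ.mul_add_mul x (Γ.mul (k x) v) w
    rw [hx, map_zero, zero_smul, h x v, Γ.mul_mul_self, Γ.mul_smul, ← h w v, θ_apply,
      Γ.ρ_cube, ← h x v] at e2
    rw [eq_neg_of_add_eq_zero_right e1, map_neg, neg_eq_iff_add_eq_zero]
    exact e2
  have key2 : ∀ x v, Γ.mul x (Γ.mul (Γ.mul x v) (k x)) = -(Γ.ρ (Γ.Q x) • Γ.mul (k x) v) := by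
    intro x v
    have e1 := Γ.mul_mul_add (k x) v x
    rw [hk, map_zero, map_zero, zero_smul] at e1
    rw [eq_neg_of_add_eq_zero_right e1, map_neg, Γ.self_mul_mul]
  -- With M_x(y) = x*(y*k(x)), this says that M_x/ρ(Q(x)) changes sign when x is replaced by w, for
  -- w orthogonal to x and k(x). It suffices to test on y = w*v, since left multiplication by w is
  -- surjective.
  have key : ∀ x w, Γ.Q w ≠ 0 → Γ.polarForm x w = 0 → Γ.polarForm (k x) w = 0 → ∀ y,
      Γ.ρ (Γ.Q w) • Γ.mul x (Γ.mul y (k x)) = -(Γ.ρ (Γ.Q x) • Γ.mul w (Γ.mul y (k w))) := by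
    intro x w hw hxw hkxw y
    obtain ⟨v, rfl⟩ := Γ.mul_left_surjective hw y
    rw [key1 x w v hxw hkxw, key2, smul_neg, neg_neg, smul_comm]
  rw [← LinearMap.restrictScalars_injective F |>.eq_iff]
  refine Γ.linearMap_ext_of_Q_ne_zero fun x₁ h₁ => ?_
  have hcard : ∀ b : Fin 4 → V, Module.finrank L (Submodule.span L (Set.range b)) ≤ 4 :=
    fun b => finrank_range_le_card (R := L) b
  -- The repeated entries only pad the family to length four.
  obtain ⟨x₂, h₂, o₂⟩ := Γ.exists_orthogonal_Q_ne_zero _ (hcard ![x₁, k x₁, x₁, k x₁])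
    (Submodule.subset_span ⟨0, rfl⟩) h₁
  obtain ⟨x₃, h₃, o₃⟩ := Γ.exists_orthogonal_Q_ne_zero _ (hcard ![x₁, k x₁, x₂, k x₂])
    (Submodule.subset_span ⟨0, rfl⟩) h₁
  have k₁₂ := key x₁ x₂ h₂ (o₂ _ (Submodule.subset_span ⟨0, rfl⟩))
    (o₂ _ (Submodule.subset_span ⟨1, rfl⟩))
  have k₁₃ := key x₁ x₃ h₃ (o₃ _ (Submodule.subset_span ⟨0, rfl⟩))
    (o₃ _ (Submodule.subset_span ⟨1, rfl⟩))
  have k₂₃ := key x₂ x₃ h₃ (o₃ _ (Submodule.subset_span ⟨2, rfl⟩))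
    (o₃ _ (Submodule.subset_span ⟨3, rfl⟩))
  have hρ : ∀ {c : L}, c ≠ 0 → Γ.ρ c ≠ 0 := fun hc => by simpa using hc
  -- Three pairwise sign changes among x₁, x₂, x₃ make M_{x₁} its own negative, hence zero.
  have hM : ∀ y, Γ.mul x₁ (Γ.mul y (k x₁)) = 0 := fun y => by
    have e₁ := congrArg (Γ.ρ (Γ.Q x₃) • ·) (k₁₂ y)
    have e₂ := congrArg (Γ.ρ (Γ.Q x₂) • ·) (k₁₃ y)
    have e₃ := congrArg (Γ.ρ (Γ.Q x₁) • ·) (k₂₃ y)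
    simp only [smul_smul, smul_neg] at e₁ e₂ e₃
    have h2 : (2 * (Γ.ρ (Γ.Q x₃) * Γ.ρ (Γ.Q x₂))) • Γ.mul x₁ (Γ.mul y (k x₁)) = 0 := by
      rw [mul_comm (Γ.ρ (Γ.Q x₁)) (Γ.ρ (Γ.Q x₃)), mul_comm (Γ.ρ (Γ.Q x₁)) (Γ.ρ (Γ.Q x₂))] at e₃
      rw [e₃, neg_neg, ← neg_eq_iff_eq_neg.2 e₂, mul_comm (Γ.ρ (Γ.Q x₂)),
        eq_neg_iff_add_eq_zero, ← add_smul, ← two_mul] at e₁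
      exact e₁
    exact (smul_eq_zero.1 h2).resolve_left
      (mul_ne_zero (two_ne_zero_of_algebra F L) (mul_ne_zero (hρ h₃) (hρ h₂)))
  exact Γ.eq_zero_of_mul_left h₁ (Γ.eq_zero_of_mul_left h₁ (hM x₁))

/-- If `k x * y = x * K y` for all `x`, `y`, then `k` is a scalar. -/
theorem exists_smul_of_mul_eq_mul (k K : Module.End L V)
    (h : ∀ x y, Γ.mul (k x) y = Γ.mul x (K y)) : ∃ a : L, ∀ x, k x = a • x := by
  obtain ⟨x₀, hx₀⟩ := Γ.exists_Q_ne_zero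
  have h2 := (two_ne_zero_of_algebra F L)
  have hρ : ∀ {c : L}, c ≠ 0 → Γ.ρ c ≠ 0 := fun hc => by simpa using hc
  set a := Γ.polarForm (k x₀) x₀ / Γ.Q x₀ with ha
  -- Both sides are b_Q(k(x)*w, x*w) = b_Q(x*K(w), x*w). Hence b_Q(k(x), x) is a constant multiple
  -- of Q(x), and since b_Q(x, x) = 2Q(x), subtracting half that constant makes k skew.
  have h1 : ∀ x w, Γ.ρ (Γ.polarForm (k x) x) * Γ.ρ (Γ.ρ (Γ.Q w)) =
      Γ.ρ (Γ.Q x) * Γ.ρ (Γ.ρ (Γ.polarForm (K w) w)) := fun x w => by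
    rw [← Γ.polar_mul_right, ← Γ.polar_mul_left, h]
  have h3 : ∀ w, Γ.ρ (Γ.ρ (Γ.polarForm (K w) w)) = Γ.ρ a * Γ.ρ (Γ.ρ (Γ.Q w)) := fun w => by
    have := h1 x₀ w
    rw [ha, map_div₀]
    field_simp [hρ hx₀]
    linear_combination -this
  have h4 : ∀ x, Γ.polarForm (k x) x = a * Γ.Q x := fun x => by
    have := h1 x x₀
    rw [h3] at this
    apply Γ.ρ.injective
    apply mul_right_cancel₀ (hρ (hρ hx₀))
    rw [this, map_mul]
    ring
  refine ⟨a / 2, fun x => ?_⟩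
  have := Γ.eq_zero_of_skew (k - (a / 2) • LinearMap.id)
    (K - (Γ.ρ (Γ.ρ (a / 2))) • LinearMap.id) (fun x y => ?_) (fun x => ?_)
  · exact sub_eq_zero.1 (LinearMap.congr_fun this x)
  · simp only [LinearMap.sub_apply, map_sub, LinearMap.smul_apply, LinearMap.id_apply,
      Γ.smul_mul, Γ.mul_smul, h, Γ.ρ_cube]
  · simp only [LinearMap.sub_apply, map_sub, LinearMap.smul_apply, LinearMap.id_apply,
      map_smul, h4, polarForm_self, smul_eq_mul]
    field_simp
    ring

end Rigidity

end CyclicComposition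

/-! ### Semilinear homomorphisms out of the even Clifford algebra. -/

section EvenClifford

open CliffordAlgebra

variable {R M A : Type*} [CommRing R] [AddCommGroup M] [Module R M] {Q : QuadraticForm R M}
  [Ring A]

theorem even_ringHom_ext {f g : even Q →+* A}
    (h : ∀ r, f (algebraMap R _ r) = g (algebraMap R _ r))
    (h' : ∀ x y, f ((even.ι Q).bilin x y) = g ((even.ι Q).bilin x y)) : f = g := by
  ext ⟨c, hc⟩
  induction c, hc using even_induction with
  | algebraMap r => exact h r
  | add x y hx hy ihx ihy =>
    exact (map_add f ⟨x, hx⟩ ⟨y, hy⟩).trans ((congrArg₂ _ ihx ihy).trans (map_add g _ _).symm)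
  | ι_mul_ι_mul x y c hc ih =>
    exact (map_mul f ((even.ι Q).bilin x y) ⟨c, hc⟩).trans
      ((congrArg₂ _ (h' x y) ih).trans (map_mul g _ _).symm)

/-- The universal property of the even Clifford algebra, for ring homomorphisms that are
semilinear with respect to `s`. -/
theorem exists_even_ringHom (s : R →+* A) (hs : ∀ r a, s r * a = a * s r) (β : M → M → A)
    (add_left : ∀ x x' y, β (x + x') y = β x y + β x' y)
    (add_right : ∀ x y y', β x (y + y') = β x y + β x y')
    (smul_left : ∀ r x y, β (r • x) y = s r * β x y)
    (smul_right : ∀ r x y, β x (r • y) = s r * β x y)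
    (contract : ∀ x, β x x = s (Q x))
    (contract_mid : ∀ x y z, β x y * β y z = s (Q y) * β x z) :
    ∃ C : even Q →+* A, (∀ r, C (algebraMap R _ r) = s r) ∧
      ∀ x y, C ((even.ι Q).bilin x y) = β x y := by
  -- Viewing the target as an R-algebra through s turns semilinear data into linear data, so the
  -- usual universal property applies.
  let _ : Algebra R A := s.toAlgebra' hs
  let E : EvenHom Q A :=
    { bilin := LinearMap.mk₂ R β add_left smul_left add_right smul_right
      contract := contract
      contract_mid := contract_mid }
  exact ⟨(even.lift Q E : even Q →ₐ[R] A).toRingHom, fun r => (even.lift Q E).commutes r,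
    fun x y => even.lift_ι Q E x y⟩

end EvenClifford

/-! ### A Skolem–Noether theorem for semilinear automorphisms of End_L V. -/

section Semilinear

variable {F L V : Type*} [Field F] [Field L] [Algebra F L]
  [AddCommGroup V] [Module F V] [Module L V]

theorem symm_smul_of_semilinear {V' : Type*} [AddCommGroup V'] [Module F V'] [Module L V']
    {ν : L ≃ₐ[F] L} {g : V ≃ₗ[F] V'} (hg : ∀ (a : L) x, g (a • x) = ν a • g x) (a : L) (x : V') :
    g.symm (a • x) = ν.symm a • g.symm x := by
  apply g.injective
  simp [hg]

variable [IsScalarTower F L V]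

theorem CyclicComposition.semilinearInt_apply {ν : L ≃ₐ[F] L} {g : V ≃ₗ[F] V}
    (hg : ∀ (a : L) x, g (a • x) = ν a • g x) (h : Module.End L V) (x : V) :
    CyclicComposition.semilinearInt ν g hg h x = g (h (g.symm x)) := rfl

open CyclicComposition

/-- Every automorphism of `End_L V` that restricts to `ν` on `L` is of the form `Int g` for a
`ν`-semilinear `g`. -/
theorem exists_eq_semilinearInt [Nontrivial V] (ν : L ≃ₐ[F] L)
    (φ : Module.End L V ≃ₐ[F] Module.End L V)
    (hφ : ∀ a, φ (algebraMap L _ a) = algebraMap L _ (ν a)) :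
    ∃ (g : V ≃ₗ[F] V) (hg : ∀ (a : L) x, g (a • x) = ν a • g x),
      φ = semilinearInt ν g hg := by
  obtain ⟨u, hu⟩ := exists_ne (0 : V)
  obtain ⟨δ, huδ⟩ := Module.Projective.exists_dual_eq_one L hu
  obtain ⟨z, hz⟩ : ∃ z : V, φ (δ.smulRight u) z ≠ 0 := by
    by_contra! h
    have h0 : δ.smulRight u = 0 := φ.injective (by rw [map_zero]; exact LinearMap.ext h)
    apply hu
    simpa [huδ] using LinearMap.congr_fun h0 u
  let T : V →ₗ[F] V :=
    { toFun := fun x => φ (δ.smulRight x) z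
      map_add' := fun x y => by
        rw [← LinearMap.add_apply, ← map_add]
        congr 2
        ext; simp
      map_smul' := fun c x => by
        rw [RingHom.id_apply, ← LinearMap.smul_apply, ← map_smul]
        congr 2
        ext y
        exact smul_comm _ c x }
  have hTA : ∀ (A : Module.End L V) x, T (A x) = φ A (T x) := fun A x => by
    change φ (δ.smulRight (A x)) z = φ A (φ (δ.smulRight x) z)
    rw [← Module.End.mul_apply, ← map_mul]
    congr 2
    ext; simp
  have hTs : ∀ (a : L) x, T (a • x) = ν a • T x := fun a x => by
    have := hTA (algebraMap L _ a) x
    rwa [hφ] at this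
  have surj : Function.Surjective T := fun w => by
    obtain ⟨d, hd⟩ := Module.Projective.exists_dual_eq_one L hz
    exact ⟨φ.symm (d.smulRight w) u, by
      rw [hTA, AlgEquiv.apply_symm_apply, LinearMap.smulRight_apply]
      change d (φ (δ.smulRight u) z) • w = w
      rw [hd, one_smul]⟩
  have inj : Function.Injective T := (injective_iff_map_eq_zero T).2 fun x hx => by
    by_contra hx0
    obtain ⟨d, hd⟩ := Module.Projective.exists_dual_eq_one L hx0
    apply hz
    have := hTA (d.smulRight u) x
    rwa [hx, map_zero, LinearMap.smulRight_apply, hd, one_smul] at this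
  obtain ⟨g, hgT⟩ : ∃ g : V ≃ₗ[F] V, ∀ x, g x = T x :=
    ⟨LinearEquiv.ofBijective T ⟨inj, surj⟩, fun x => rfl⟩
  refine ⟨g, fun a x => by rw [hgT, hgT, hTs], ?_⟩
  ext A x
  obtain ⟨y, rfl⟩ := g.surjective x
  rw [semilinearInt_apply, LinearEquiv.symm_apply_apply, hgT, hgT, hTA]

theorem semilinearInt_algebraMap {ν : L ≃ₐ[F] L} {g : V ≃ₗ[F] V}
    (hg : ∀ (a : L) x, g (a • x) = ν a • g x) (a : L) :
    semilinearInt ν g hg (algebraMap L _ a) = algebraMap L _ (ν a) := by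
  ext x
  simp [semilinearInt_apply, Module.algebraMap_end_apply, hg]

/-- Semilinear maps that induce the same automorphism differ by a scalar. -/
theorem exists_smul_of_semilinearInt_eq [Nontrivial V] {ν ν' : L ≃ₐ[F] L} {g g' : V ≃ₗ[F] V}
    (hg : ∀ (a : L) x, g (a • x) = ν a • g x) (hg' : ∀ (a : L) x, g' (a • x) = ν' a • g' x)
    (h : semilinearInt ν g hg = semilinearInt ν' g' hg') :
    ∃ c : L, c ≠ 0 ∧ ∀ x, g x = c • g' x := by
  obtain ⟨u, hu⟩ := exists_ne (0 : V)
  obtain ⟨δ, huδ⟩ := Module.Projective.exists_dual_eq_one L hu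
  have hc : ∀ x, g x = ν' (δ (g'.symm (g u))) • g' x := fun x => by
    -- As δ(u) = 1, the left side is g(x), while the right side is visibly a multiple of g'(x) with
    -- factor independent of x.
    have h1 := LinearMap.congr_fun (DFunLike.congr_fun h (δ.smulRight x)) (g u)
    rwa [semilinearInt_apply, semilinearInt_apply, g.symm_apply_apply,
      LinearMap.smulRight_apply, LinearMap.smulRight_apply, huδ, one_smul, hg'] at h1
  refine ⟨_, fun h0 => hu ?_, hc⟩
  apply g.injective
  rw [hc, h0, zero_smul, map_zero]

end Semilinear

/-! ### Automorphisms of End Γ and self-isotopies of Γ. -/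

namespace CyclicComposition

section Isotopy

variable {F : Type u} {L : Type v} {V V' : Type*} [Field F] [Field L] [Algebra F L]
  [AddCommGroup V] [Module F V] [Module L V] [IsScalarTower F L V]
  [AddCommGroup V'] [Module F V'] [Module L V'] [IsScalarTower F L V']

theorem nontrivial (Γ : CyclicComposition F L V) : Nontrivial V :=
  Module.nontrivial_of_finrank_pos (R := L) (by rw [Γ.finrank_eq_eight]; norm_num)

/-- The product determines the quadratic form through (x*y)*x = ρ²(Q(x))y, so the condition on Q in
an isotopy is automatic. -/
theorem isIsotopy_of_mul {Γ : CyclicComposition F L V} {Γ' : CyclicComposition F L V'}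
    {ν : L ≃ₐ[F] L} {f : V ≃ₗ[F] V'} (hν : ∀ a, ν (Γ.ρ a) = Γ'.ρ (ν a))
    (hf : ∀ (a : L) x, f (a • x) = ν a • f x) {μ : L} (hμ : μ ≠ 0)
    (h : ∀ x y, Γ'.mul (f x) (f y) = ν μ • f (Γ.mul x y)) : IsIsotopy Γ Γ' ν f := by
  refine ⟨hν, hf, Units.mk0 μ hμ, fun x => ?_, h⟩
  have := Γ.nontrivial
  obtain ⟨y, hy⟩ := exists_ne (0 : V)
  have h1 := Γ'.mul_mul_self (f x) (f y)
  rw [h, Γ'.smul_mul, h, mul_mul_self, hf, smul_smul, smul_smul] at h1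
  have h2 := smul_left_injective L (f.map_ne_zero_iff.2 hy) h1
  apply Γ'.θ.injective
  rw [← h2]
  simp only [Units.val_mk0, θ_apply, map_mul, ← hν, Γ.ρ_cube]
  ring

variable {Γ : CyclicComposition F L V}

theorem polarForm_of_Q_eq {ν : L ≃ₐ[F] L} {g : V ≃ₗ[F] V} {m : L}
    (hQ : ∀ x, Γ.Q (g x) = ν m * ν (Γ.Q x)) (x y : V) :
    Γ.polarForm (g x) (g y) = ν m * ν (Γ.polarForm x y) := by
  simp only [QuadraticMap.polarBilin_apply_apply, QuadraticMap.polar, ← map_add, hQ]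
  simp only [map_sub]
  ring

/-- Nondegeneracy of b_Q identifies V ⊗ V with End_L V, so rank-one operators suffice for additive
statements. -/
theorem end_induction (Γ : CyclicComposition F L V) {P : Module.End L V → Prop} (zero : P 0)
    (add : ∀ h h', P h → P h' → P (h + h')) (rank_one : ∀ x y, P ((Γ.polarForm y).smulRight x))
    (h : Module.End L V) : P h := by
  have := Γ.finiteDimensional
  obtain ⟨t, rfl⟩ := (TensorProduct.congr
      (LinearMap.BilinForm.toDual Γ.polarForm Γ.nondegenerate)
      (LinearEquiv.refl L V) ≪≫ₗ dualTensorHomEquiv L V V).surjective h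
  induction t with
  | zero => rwa [map_zero]
  | add s t hs ht => rw [map_add]; exact add _ _ hs ht
  | tmul y x =>
    convert rank_one x y using 1
    ext z
    simp [dualTensorHomEquiv, LinearMap.BilinForm.toDual_def]

theorem semilinearInt_smulRight {ν : L ≃ₐ[F] L} {g : V ≃ₗ[F] V}
    (hg : ∀ (a : L) x, g (a • x) = ν a • g x) {m : L} (hm : m ≠ 0)
    (hb : ∀ x y, Γ.polarForm (g x) (g y) = ν m * ν (Γ.polarForm x y)) (x y : V) :
    semilinearInt ν g hg ((Γ.polarForm y).smulRight x) =
      (ν m)⁻¹ • (Γ.polarForm (g y)).smulRight (g x) := by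
  ext z
  obtain ⟨z, rfl⟩ := g.surjective z
  rw [semilinearInt_apply, LinearEquiv.symm_apply_apply, LinearMap.smul_apply,
    LinearMap.smulRight_apply, LinearMap.smulRight_apply, hg, hb, smul_smul,
    inv_mul_cancel_left₀ (by simpa using hm)]

/-- This is C(Int g): the factor ν(m)⁻¹ is the one by which Int g acts on x ⊗ y in
`semilinearInt_smulRight`. The inverse is the same construction for g⁻¹. -/
theorem exists_even_ringEquiv {ν : L ≃ₐ[F] L} {g : V ≃ₗ[F] V}
    (hg : ∀ (a : L) x, g (a • x) = ν a • g x) {m : L} (hm : m ≠ 0)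
    (hQ : ∀ x, Γ.Q (g x) = ν m * ν (Γ.Q x)) :
    ∃ C : CliffordAlgebra.even Γ.Q ≃+* CliffordAlgebra.even Γ.Q,
      (∀ a, C (algebraMap L _ a) = algebraMap L _ (ν a)) ∧
      ∀ x y, C ((CliffordAlgebra.even.ι Γ.Q).bilin x y) =
        (ν m)⁻¹ • (CliffordAlgebra.even.ι Γ.Q).bilin (g x) (g y) := by
  have key : ∀ {ν : L ≃ₐ[F] L} {g : V ≃ₗ[F] V}
      (hg : ∀ (a : L) x, g (a • x) = ν a • g x) {m : L} (hm : m ≠ 0)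
      (hQ : ∀ x, Γ.Q (g x) = ν m * ν (Γ.Q x)),
      ∃ C : CliffordAlgebra.even Γ.Q →+* CliffordAlgebra.even Γ.Q,
      (∀ a, C (algebraMap L _ a) = algebraMap L _ (ν a)) ∧
      ∀ x y, C ((CliffordAlgebra.even.ι Γ.Q).bilin x y) =
        (ν m)⁻¹ • (CliffordAlgebra.even.ι Γ.Q).bilin (g x) (g y) := by
    intro ν g hg m hm hQ
    have hm' : ν m ≠ 0 := by simpa using hm
    refine exists_even_ringHom ((algebraMap L _).comp (ν : L →+* L))
      (fun r a => Algebra.commutes _ _) _ (fun x x' y => ?_) (fun x y y' => ?_)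
      (fun r x y => ?_) (fun r x y => ?_) (fun x => ?_) (fun x y z => ?_)
    · simp
    · simp
    · rw [hg, map_smul, LinearMap.smul_apply, smul_comm, Algebra.smul_def (ν r)]
      rfl
    · rw [hg, map_smul, smul_comm, Algebra.smul_def (ν r)]
      rfl
    · rw [(CliffordAlgebra.even.ι Γ.Q).contract, hQ, Algebra.smul_def, ← map_mul,
        inv_mul_cancel_left₀ hm']
      rfl
    · rw [smul_mul_smul_comm, (CliffordAlgebra.even.ι Γ.Q).contract_mid, hQ, smul_smul]
      change _ = algebraMap L _ (ν (Γ.Q y)) * _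
      rw [← Algebra.smul_def, smul_smul]
      congr 1
      field_simp
  have hm' : ν m ≠ 0 := by simpa using hm
  obtain ⟨C, hC, hC'⟩ := key hg hm hQ
  obtain ⟨D, hD, hD'⟩ := key (symm_smul_of_semilinear hg) (inv_ne_zero hm') (fun x => by
    rw [← map_mul]
    apply ν.injective
    rw [AlgEquiv.apply_symm_apply, eq_inv_mul_iff_mul_eq₀ hm', ← hQ, g.apply_symm_apply])
  refine ⟨RingEquiv.ofRingHom C D (even_ringHom_ext (fun a => ?_) fun x y => ?_)
    (even_ringHom_ext (fun a => ?_) fun x y => ?_), hC, hC'⟩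
  · simp [hC, hD]
  · rw [RingHom.comp_apply, hD', Algebra.smul_def, map_mul, hC, hC', ← Algebra.smul_def]
    simp [smul_smul, hm]
  · simp [hC, hD]
  · rw [RingHom.comp_apply, hC', Algebra.smul_def, map_mul, hD, hD', ← Algebra.smul_def]
    simp [smul_smul, hm]

theorem alphaEven_bilin (x y : V) :
    Γ.alphaEven ((CliffordAlgebra.even.ι Γ.Q).bilin x y) = Γ.alphaPair x y := by
  rw [alphaEven, CliffordAlgebra.even.lift_ι, LinearMap.mk₂_apply]

theorem endMap_semilinearInt_apply (κ : L ≃ₐ[F] L) {ν : L ≃ₐ[F] L} {g : V ≃ₗ[F] V}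
    (hg : ∀ (a : L) x, g (a • x) = ν a • g x) (T : Module.End L (Twist κ V)) (x : V) :
    Twist.endMap κ (semilinearInt ν g hg).toRingEquiv T (Twist.of κ (g x)) =
      Twist.of κ (g ((Twist.of κ).symm (T (Twist.of κ x)))) :=
  congrArg (fun z => Twist.of κ (g ((Twist.of κ).symm (T (Twist.of κ z))))) (g.symm_apply_apply x)

theorem rightMap_leftMap_of (x y z : V) :
    Γ.rightMap x (Γ.leftMap y (Twist.of Γ.ρ z)) = Twist.of Γ.ρ (Γ.mul (Γ.mul y z) x) := rfl

theorem leftMap_rightMap_of (x y z : V) :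
    Γ.leftMap x (Γ.rightMap y (Twist.of Γ.θ z)) = Twist.of Γ.θ (Γ.mul x (Γ.mul z y)) := rfl

theorem smul_of_ρ (a : L) (x : V) : a • Twist.of Γ.ρ x = Twist.of Γ.ρ (Γ.θ a • x) := by
  rw [Twist.of_smul, θ_apply, Γ.ρ_cube]

theorem smul_of_θ (a : L) (x : V) : a • Twist.of Γ.θ x = Twist.of Γ.θ (Γ.ρ a • x) := by
  rw [Twist.of_smul, θ_apply, Γ.ρ_cube]

/-- An isotopy `g` of `Γ` with itself induces an automorphism `Int g` of `End Γ`. -/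
theorem IsIsotopy.semilinearInt_mem {ν : L ≃ₐ[F] L} {g : V ≃ₗ[F] V}
    (hI : IsIsotopy Γ Γ ν g) (hg : ∀ (a : L) x, g (a • x) = ν a • g x) :
    semilinearInt ν g hg ∈ Γ.autEnd := by
  obtain ⟨hν, -, μ, hQ, hmul⟩ := hI
  have hμ : (μ : L) ≠ 0 := μ.ne_zero
  have hm : Γ.ρ μ * Γ.ρ (Γ.ρ μ) ≠ 0 := by simp
  simp only [map_mul ν (_ * _)] at hQ
  have hb := polarForm_of_Q_eq hQ
  refine ⟨fun A => ?_, ⟨ν, hν, semilinearInt_algebraMap hg⟩, ?_⟩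
  · have := Γ.finiteDimensional
    refine (LinearMap.BilinForm.isAdjointPair_iff_eq_of_nondegenerate _ Γ.nondegenerate _ _).1
      fun x y => ?_
    obtain ⟨x, rfl⟩ := g.surjective x
    obtain ⟨y, rfl⟩ := g.surjective y
    rw [semilinearInt_apply, semilinearInt_apply, g.symm_apply_apply, g.symm_apply_apply]
    refine (hb _ _).trans (Eq.trans ?_ (hb _ _).symm)
    congr 2
    exact LinearMap.BilinForm.isAdjointPairLeftAdjointOfNondegenerate _ Γ.nondegenerate A x y
  · obtain ⟨C, hC, hC'⟩ := exists_even_ringEquiv hg hm hQ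
    refine ⟨C, fun h => ?_, fun c => ?_⟩
    · induction h using Γ.end_induction with
      | zero => simp
      | add h h' ih ih' => simp only [map_add, ih, ih']
      | rank_one x y =>
        rw [canonicalMap_apply, hC', semilinearInt_smulRight hg hm hb, map_smul,
          canonicalMap_apply]
    · let G : CliffordAlgebra.even Γ.Q →+*
          Module.End L (Twist Γ.ρ V) × Module.End L (Twist Γ.θ V) :=
        (RingHom.prodMap (Twist.endMap Γ.ρ (semilinearInt ν g hg).toRingEquiv : _ →+* _)
          (Twist.endMap Γ.θ (semilinearInt ν g hg).toRingEquiv : _ →+* _)).comp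
          Γ.alphaEven.toRingHom
      suffices Γ.alphaEven.toRingHom.comp (C : _ →+* _) = G from DFunLike.congr_fun this c
      refine even_ringHom_ext (fun a => ?_) (fun x y => ?_)
      · change Γ.alphaEven (C (algebraMap L _ a)) = (Twist.endMap Γ.ρ _ (Γ.alphaEven _).1,
          Twist.endMap Γ.θ _ (Γ.alphaEven _).2)
        rw [hC, AlgHom.commutes, AlgHom.commutes]
        refine Prod.ext (LinearMap.ext fun z => ?_) (LinearMap.ext fun z => ?_)
        · obtain ⟨z, rfl⟩ := (Twist.of Γ.ρ).surjective z
          obtain ⟨z, rfl⟩ := g.surjective z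
          rw [endMap_semilinearInt_apply]
          simp only [Prod.algebraMap_apply, Module.algebraMap_end_apply, smul_of_ρ,
            AddEquiv.symm_apply_apply, hg, θ_apply, hν]
        · obtain ⟨z, rfl⟩ := (Twist.of Γ.θ).surjective z
          obtain ⟨z, rfl⟩ := g.surjective z
          rw [endMap_semilinearInt_apply]
          simp only [Prod.algebraMap_apply, Module.algebraMap_end_apply, smul_of_θ,
            AddEquiv.symm_apply_apply, hg, hν]
      · change Γ.alphaEven (C _) = (Twist.endMap Γ.ρ _ (Γ.alphaEven _).1,
          Twist.endMap Γ.θ _ (Γ.alphaEven _).2)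
        rw [hC', map_smul, alphaEven_bilin, alphaEven_bilin]
        refine Prod.ext (LinearMap.ext fun z => ?_) (LinearMap.ext fun z => ?_)
        · obtain ⟨z, rfl⟩ := (Twist.of Γ.ρ).surjective z
          obtain ⟨z, rfl⟩ := g.surjective z
          rw [endMap_semilinearInt_apply]
          simp only [Prod.smul_mk, alphaPair, LinearMap.smul_apply, LinearMap.comp_apply,
            rightMap_leftMap_of, AddEquiv.symm_apply_apply, smul_of_ρ]
          rw [hmul, Γ.smul_mul, hmul, smul_smul, smul_smul, ← hν, ← map_inv₀, θ_apply, ← hν,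
            ← hν, ← map_mul, ← map_mul]
          simp only [map_inv₀, map_mul, Γ.ρ_cube]
          rw [mul_assoc, mul_comm (ν (Γ.ρ _)), inv_mul_cancel₀ (by simp), one_smul]
        · obtain ⟨z, rfl⟩ := (Twist.of Γ.θ).surjective z
          obtain ⟨z, rfl⟩ := g.surjective z
          rw [endMap_semilinearInt_apply]
          simp only [Prod.smul_mk, alphaPair, LinearMap.smul_apply, LinearMap.comp_apply,
            leftMap_rightMap_of, AddEquiv.symm_apply_apply, smul_of_θ]
          rw [hmul, Γ.mul_smul, hmul, smul_smul, smul_smul, ← hν, ← hν, ← map_inv₀, ← hν,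
            ← map_mul, ← map_mul]
          simp only [map_inv₀, map_mul, Γ.ρ_cube]
          rw [mul_assoc, inv_mul_cancel₀ (by simp), one_smul]

/-- A semilinear `g` such that `Int g` commutes with `σ_Q` is a semilinear similitude. -/
theorem exists_multiplier {ν : L ≃ₐ[F] L} {g : V ≃ₗ[F] V}
    (hg : ∀ (a : L) x, g (a • x) = ν a • g x)
    (h : ∀ A, semilinearInt ν g hg (Γ.adjointInvolution A) =
      Γ.adjointInvolution (semilinearInt ν g hg A)) :
    ∃ m : L, m ≠ 0 ∧ ∀ x y, Γ.polarForm (g x) (g y) = ν m * ν (Γ.polarForm x y) := by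
  have := Γ.finiteDimensional
  have hσ : ∀ A x y, Γ.polarForm (Γ.adjointInvolution A x) y = Γ.polarForm x (A y) :=
    fun A => LinearMap.BilinForm.isAdjointPairLeftAdjointOfNondegenerate _ Γ.nondegenerate A
  have hadj : ∀ x y, Γ.adjointInvolution ((Γ.polarForm y).smulRight x) =
      (Γ.polarForm x).smulRight y := fun x y => by
    refine ((LinearMap.BilinForm.isAdjointPair_iff_eq_of_nondegenerate _ Γ.nondegenerate
      _ _).1 fun z w => ?_).symm
    simp only [LinearMap.smulRight_apply, map_smul, LinearMap.smul_apply, smul_eq_mul,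
      Γ.polar_symm x z]
    ring
  -- Adjointness for the image of the rank-one operator x ⊗ y, whose adjoint is y ⊗ x. Fixing x, z
  -- with b_Q(x, z) ≠ 0 then gives the multiplier.
  have key : ∀ x y z w, ν (Γ.polarForm x z) * Γ.polarForm (g y) (g w) =
      ν (Γ.polarForm y w) * Γ.polarForm (g z) (g x) := fun x y z w => by
    have h1 := hσ (semilinearInt ν g hg ((Γ.polarForm y).smulRight x)) (g z) (g w)
    rw [← h, hadj, semilinearInt_apply, semilinearInt_apply, g.symm_apply_apply,
      g.symm_apply_apply, LinearMap.smulRight_apply, LinearMap.smulRight_apply, hg, hg,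
      map_smul, map_smul] at h1
    exact h1
  have := Γ.nontrivial
  obtain ⟨x₀, hx₀⟩ := exists_ne (0 : V)
  obtain ⟨z₀, hz₀⟩ : ∃ z, Γ.polarForm x₀ z ≠ 0 := by
    by_contra! h0
    exact hx₀ (Γ.nondegenerate.1 x₀ h0)
  have hz₀' : ν (Γ.polarForm x₀ z₀) ≠ 0 := by simpa using hz₀
  have hb : ∀ y w, Γ.polarForm (g y) (g w) = ν (ν.symm (Γ.polarForm (g z₀) (g x₀) /
      ν (Γ.polarForm x₀ z₀))) * ν (Γ.polarForm y w) := fun y w => by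
    rw [ν.apply_symm_apply, div_mul_eq_mul_div, eq_div_iff hz₀', mul_comm, key, mul_comm]
  refine ⟨_, fun h0 => hz₀ ?_, hb⟩
  have h1 := hb (g.symm x₀) (g.symm z₀)
  rwa [h0, map_zero, zero_mul, g.apply_symm_apply, g.apply_symm_apply] at h1

/-- Every automorphism of `End Γ` is induced by an isotopy of `Γ` with itself. -/
theorem exists_isIsotopy_of_mem_autEnd [NeZero (2 : F)]
    {φ : Module.End L V ≃ₐ[F] Module.End L V}
    (h : φ ∈ Γ.autEnd) : ∃ (ν : L ≃ₐ[F] L) (g : V ≃ₗ[F] V)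
      (hg : ∀ (a : L) x, g (a • x) = ν a • g x), IsIsotopy Γ Γ ν g ∧ φ = semilinearInt ν g hg := by
  have := Γ.nontrivial
  obtain ⟨hσ, ⟨ν, hν, hφ⟩, C, hC, hα⟩ := h
  obtain ⟨g, hg, rfl⟩ := exists_eq_semilinearInt ν φ hφ
  refine ⟨ν, g, hg, ?_, rfl⟩
  obtain ⟨m, hm, hb⟩ := exists_multiplier hg hσ
  have hαg : ∀ x y, (ν m)⁻¹ • Γ.alphaPair (g x) (g y) =
      (Twist.endMap Γ.ρ (semilinearInt ν g hg).toRingEquiv (Γ.alphaPair x y).1,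
        Twist.endMap Γ.θ (semilinearInt ν g hg).toRingEquiv (Γ.alphaPair x y).2) := fun x y => by
    rw [← alphaEven_bilin, ← alphaEven_bilin, ← hα, ← map_smul, ← canonicalMap_apply,
      ← canonicalMap_apply, ← map_smul, hC, semilinearInt_smulRight hg hm hb]
  set c₁ := Γ.θ (ν m)⁻¹
  set c₂ := Γ.ρ (ν m)⁻¹
  have hA : ∀ x y z, g (Γ.mul (Γ.mul y z) x) =
      c₁ • Γ.mul (Γ.mul (g y) (g z)) (g x) := fun x y z => by
    have h1 := LinearMap.congr_fun (congrArg Prod.fst (hαg x y)) (Twist.of Γ.ρ (g z))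
    rw [endMap_semilinearInt_apply] at h1
    simp only [Prod.smul_mk, alphaPair, LinearMap.smul_apply, LinearMap.comp_apply,
      rightMap_leftMap_of, AddEquiv.symm_apply_apply, smul_of_ρ] at h1
    exact ((Twist.of Γ.ρ).injective h1).symm
  have hB : ∀ x y z, g (Γ.mul x (Γ.mul z y)) =
      c₂ • Γ.mul (g x) (Γ.mul (g z) (g y)) := fun x y z => by
    have h1 := LinearMap.congr_fun (congrArg Prod.snd (hαg x y)) (Twist.of Γ.θ (g z))
    rw [endMap_semilinearInt_apply] at h1
    simp only [Prod.smul_mk, alphaPair, LinearMap.smul_apply, LinearMap.comp_apply,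
      leftMap_rightMap_of, AddEquiv.symm_apply_apply, smul_of_θ] at h1
    exact ((Twist.of Γ.θ).injective h1).symm
  obtain ⟨x₀, hx₀⟩ := Γ.exists_Q_ne_zero
  have hgs := symm_smul_of_semilinear hg
  have hνs : ∀ a, Γ.ρ (ν a) = ν (Γ.ρ a) := fun a => (hν a).symm
  -- For z = ρ²(Q(x₀))⁻¹(x*x₀) one has x = x₀*z, so g(x*y) = g((x₀*z)*y) is c₁(gx₀*gz)*gy by `hA`.
  -- The outer twist ρ²(c₁) moves c₁ inside the left factor. `K` is the mirror image, using `hB`.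
  let k : Module.End L V :=
    { toFun := fun v => Γ.ρ (Γ.ρ c₁) • Γ.mul (g x₀)
        (g ((Γ.θ (Γ.Q x₀))⁻¹ • Γ.mul (g.symm v) x₀))
      map_add' := fun x y => by simp
      map_smul' := fun a x => by
        simp only [hgs, Γ.smul_mul, smul_comm _ (Γ.ρ (ν.symm a)), hg, Γ.mul_smul, hνs,
          Γ.ρ_cube, ν.apply_symm_apply, RingHom.id_apply, smul_comm _ a] }
  let K : Module.End L V :=
    { toFun := fun v => Γ.ρ c₂ • Γ.mul
        (g ((Γ.ρ (Γ.Q x₀))⁻¹ • Γ.mul x₀ (g.symm v))) (g x₀)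
      map_add' := fun x y => by simp
      map_smul' := fun a x => by
        simp only [hgs, Γ.mul_smul, smul_comm _ (Γ.ρ (Γ.ρ (ν.symm a))), hg, Γ.smul_mul, hνs,
          Γ.ρ_cube, ν.apply_symm_apply, RingHom.id_apply, smul_comm _ a] }
  have hk : ∀ x y, g (Γ.mul x y) = Γ.mul (k (g x)) (g y) := fun x y => by
    change _ = Γ.mul (Γ.ρ (Γ.ρ c₁) • Γ.mul (g x₀)
        (g ((Γ.θ (Γ.Q x₀))⁻¹ • Γ.mul (g.symm (g x)) x₀))) (g y)
    rw [Γ.smul_mul, Γ.ρ_cube, ← hA, g.symm_apply_apply, Γ.mul_smul, Γ.self_mul_mul,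
      θ_apply, map_inv₀, map_inv₀, Γ.ρ_cube, inv_smul_smul₀ (by simpa using hx₀)]
  have hK : ∀ x y, g (Γ.mul x y) = Γ.mul (g x) (K (g y)) := fun x y => by
    change _ = Γ.mul (g x) (Γ.ρ c₂ • Γ.mul
        (g ((Γ.ρ (Γ.Q x₀))⁻¹ • Γ.mul x₀ (g.symm (g y)))) (g x₀))
    rw [Γ.mul_smul, Γ.ρ_cube, ← hB, g.symm_apply_apply, Γ.smul_mul, Γ.mul_mul_self, θ_apply, map_inv₀,
      inv_smul_smul₀ (by simpa using hx₀)]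
  obtain ⟨a, ha⟩ := Γ.exists_smul_of_mul_eq_mul k K fun x y => by
    obtain ⟨x, rfl⟩ := g.surjective x
    obtain ⟨y, rfl⟩ := g.surjective y
    rw [← hk, hK]
  have hmul : ∀ x y, g (Γ.mul x y) = Γ.ρ a • Γ.mul (g x) (g y) := fun x y => by
    rw [hk, ha, Γ.smul_mul]
  have ha0 : Γ.ρ a ≠ 0 := fun h0 => by
    obtain ⟨y, hy⟩ := exists_ne (0 : V)
    refine hy (Γ.eq_zero_of_mul_left hx₀ (g.injective ?_))
    rw [hmul, h0, zero_smul, map_zero]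
  refine isIsotopy_of_mul hν hg (μ := ν.symm (Γ.ρ a)⁻¹) (by simpa using ha0) fun x y => ?_
  rw [hmul, ν.apply_symm_apply, inv_smul_smul₀ ha0]

end Isotopy

end CyclicComposition

/-! ### Galois theory and descent for the cyclic cubic extension L/F. -/

namespace CyclicCubic

variable {F : Type u} {L : Type v} [Field F] [Field L] [Algebra F L] (K : CyclicCubic F L)

theorem ρ_cube (a : L) : K.ρ (K.ρ (K.ρ a)) = a := by
  have := pow_orderOf_eq_one K.ρ
  rw [K.orderOf_ρ] at this
  exact DFunLike.congr_fun this a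

theorem exists_algebraMap_eq {a : L} (ha : K.ρ a = a) : ∃ c : F, algebraMap F L c = a := by
  have hfin : FiniteDimensional F L :=
    Module.finite_of_finrank_pos (by rw [K.finrank_eq]; norm_num)
  let H := Subgroup.zpowers K.ρ
  have h1 : Module.finrank (IntermediateField.fixedField H) L = 3 := by
    rw [IntermediateField.finrank_fixedField_eq_card, Nat.card_zpowers, K.orderOf_ρ]
  have h2 := Module.finrank_mul_finrank F (IntermediateField.fixedField H) L
  rw [h1, K.finrank_eq] at h2
  have h3 : IntermediateField.fixedField H = ⊥ :=
    IntermediateField.finrank_eq_one_iff.1 (by omega)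
  refine IntermediateField.mem_bot.1 (h3 ▸ IntermediateField.mem_fixedField_iff H a |>.2 ?_)
  intro f hf
  have h4 : H ≤ MulAction.stabilizer (L ≃ₐ[F] L) a := Subgroup.zpowers_le.2 ha
  exact h4 hf

/-- Independence of the characters `1`, `ρ`, `ρ²`. -/
theorem eq_zero_of_forall_add_eq_zero {c₀ c₁ c₂ : L}
    (h : ∀ a, c₀ * a + c₁ * K.ρ a + c₂ * K.ρ (K.ρ a) = 0) : c₀ = 0 := by
  let f : Fin 3 → (L →* L) := fun i => ((K.ρ ^ (i : ℕ) : L ≃ₐ[F] L) : L →* L)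
  have hf : Function.Injective f := fun i j hij => by
    apply Fin.ext
    refine pow_injOn_Iio_orderOf (x := K.ρ) ?_ ?_ (AlgEquiv.ext fun a => DFunLike.congr_fun hij a)
    · simp [K.orderOf_ρ]
    · simp [K.orderOf_ρ]
  have hli := (linearIndependent_monoidHom L L).comp f hf
  rw [Fintype.linearIndependent_iff] at hli
  refine hli ![c₀, c₁, c₂] ?_ 0
  ext a
  simpa [Fin.sum_univ_three, f, pow_two] using h a

/-- Hilbert's Theorem 90 for `L/F`. -/
theorem exists_ρ_eq_mul {c : L} (hc : c * K.ρ c * K.ρ (K.ρ c) = 1) :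
    ∃ η : L, η ≠ 0 ∧ K.ρ η = c * η := by
  have hc0 : c ≠ 0 := by rintro rfl; simp at hc
  have hρ : ∀ {c : L}, c ≠ 0 → K.ρ c ≠ 0 := fun hc => by simpa using hc
  -- The Lagrange resolvent, nonzero for some a by independence of characters.
  obtain ⟨a, ha⟩ : ∃ a, 1 * a + c⁻¹ * K.ρ a + (c⁻¹ * (K.ρ c)⁻¹) * K.ρ (K.ρ a) ≠ 0 := by
    by_contra! h
    exact one_ne_zero (K.eq_zero_of_forall_add_eq_zero h)
  refine ⟨_, ha, ?_⟩
  simp only [map_add, map_mul, map_inv₀, K.ρ_cube, map_one]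
  have := hρ hc0
  have := hρ this
  field_simp
  linear_combination (-a) * hc

variable {V : Type*} [AddCommGroup V] [Module F V] [Module L V]

/-- The traces av + t(av) + t²(av) are fixed. A functional killing all of them yields, as a varies,
a relation between 1, ρ, ρ² with coefficient f(v) at 1, so f(v) = 0. -/
theorem span_fixed_eq_top {t : V ≃ₗ[F] V} (ht : ∀ (a : L) x, t (a • x) = K.ρ a • t x)
    (ht3 : ∀ x, t (t (t x)) = x) : Submodule.span L {x | t x = x} = ⊤ := by
  by_contra hne
  obtain ⟨f, hf, hle⟩ := Submodule.exists_le_ker_of_lt_top _ (lt_top_iff_ne_top.2 hne)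
  refine hf (LinearMap.ext fun v => K.eq_zero_of_forall_add_eq_zero
    (c₁ := f (t v)) (c₂ := f (t (t v))) fun a => ?_)
  have h1 : t (a • v + K.ρ a • t v + K.ρ (K.ρ a) • t (t v)) =
      a • v + K.ρ a • t v + K.ρ (K.ρ a) • t (t v) := by
    simp only [map_add, ht, ht3, K.ρ_cube]
    abel
  have h2 := hle (Submodule.subset_span h1)
  simpa [mul_comm] using h2

/-- Galois descent for vector spaces: a semilinear `t` with `t³ = 1` has a fixed basis. -/
theorem exists_fixed_basis {n : ℕ} (hn : 0 < n) (hV : Module.finrank L V = n) {t : V ≃ₗ[F] V}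
    (ht : ∀ (a : L) x, t (a • x) = K.ρ a • t x) (ht3 : ∀ x, t (t (t x)) = x) :
    ∃ b : Module.Basis (Fin n) L V, ∀ i, t (b i) = b i := by
  have : FiniteDimensional L V := Module.finite_of_finrank_pos (by omega)
  let b := Module.Basis.ofSpan (K.span_fixed_eq_top ht ht3).ge
  have hb : ∀ i, t (b i) = b i := fun i =>
    Module.Basis.ofSpan_subset (K.span_fixed_eq_top ht ht3).ge ⟨i, rfl⟩
  exact ⟨b.reindex (b.indexEquiv (Module.finBasisOfFinrankEq L V hV)), fun i => by
    rw [Module.Basis.reindex_apply, hb]⟩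

/-- The elements of `L ⊗ S` fixed under `ρ ⊗ 1` are those of `S`. -/
theorem exists_eq_one_tmul {S ι : Type*} [AddCommGroup S] [Module F S] [Fintype ι]
    (b : Module.Basis ι F S) {x : L ⊗[F] S}
    (hx : TensorProduct.congr K.ρ.toLinearEquiv (LinearEquiv.refl F S) x = x) :
    ∃ s, x = 1 ⊗ₜ s := by
  have hr : ∀ y i, (Module.Basis.baseChange L b).repr
      (TensorProduct.congr K.ρ.toLinearEquiv (LinearEquiv.refl F S) y) i =
      K.ρ ((Module.Basis.baseChange L b).repr y i) := fun y i => by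
    induction y with
    | zero => simp
    | add y z hy hz => simp only [map_add, Finsupp.add_apply, hy, hz]
    | tmul a s => simp
  have h1 : ∀ i, ∃ c : F, algebraMap F L c = (Module.Basis.baseChange L b).repr x i := fun i =>
    K.exists_algebraMap_eq (by rw [← hr, hx])
  choose c hc using h1
  refine ⟨∑ i, c i • b i, (Module.Basis.baseChange L b).ext_elem fun i => ?_⟩
  rw [← hc, Module.Basis.baseChange_repr_tmul]
  rw [Module.Basis.repr_sum_self, Algebra.smul_def, mul_one]

theorem one_tmul_injective {F L S : Type*} [Field F] [Field L] [Algebra F L]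
    [AddCommGroup S] [Module F S] :
    Function.Injective (fun s : S => (1 : L) ⊗ₜ[F] s) :=
  Module.FaithfullyFlat.tensorProduct_mk_injective S

end CyclicCubic

/-! ### The automorphism attached to a symmetric composition and an isotopy. -/

namespace CyclicComposition

section SemilinearInt

variable {F L V : Type*} [Field F] [Field L] [Algebra F L]
  [AddCommGroup V] [Module F V] [Module L V] [IsScalarTower F L V]

theorem semilinearInt_eq_of_smul {ν : L ≃ₐ[F] L} {g g' : V ≃ₗ[F] V}
    (hg : ∀ (a : L) x, g (a • x) = ν a • g x) (hg' : ∀ (a : L) x, g' (a • x) = ν a • g' x)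
    {c : L} (h : ∀ x, g x = c • g' x) : semilinearInt ν g hg = semilinearInt ν g' hg' := by
  ext A x
  obtain ⟨x, rfl⟩ := g.surjective x
  have hx : g'.symm (g x) = ν.symm c • x := by
    rw [h, symm_smul_of_semilinear hg', g'.symm_apply_apply]
  rw [semilinearInt_apply, semilinearInt_apply, g.symm_apply_apply, hx, map_smul, hg',
    ν.apply_symm_apply, h]

theorem semilinearInt_mul {ν κ : L ≃ₐ[F] L} {g t : V ≃ₗ[F] V}
    (hg : ∀ (a : L) x, g (a • x) = ν a • g x) (ht : ∀ (a : L) x, t (a • x) = κ a • t x) :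
    semilinearInt ν g hg * semilinearInt κ t ht =
      semilinearInt (κ.trans ν) (t.trans g) (fun a x => by simp [hg, ht]) := rfl

end SemilinearInt

section ConjHat

variable {F : Type u} {L : Type v} {V : Type w} [Field F] [Field L] [Algebra F L]
  [AddCommGroup V] [Module F V] [Module L V] [IsScalarTower F L V]
  (Γ : CyclicComposition F L V)

/-- The semilinear map `f ∘ ρ̂ ∘ f⁻¹`. -/
def conjHat (A : SymmetricComposition F) (f : (L ⊗[F] A.S) ≃ₗ[L] V) : V ≃ₗ[F] V :=
  ((f.restrictScalars F).symm.trans (A.hatEquiv Γ.ρ)).trans (f.restrictScalars F)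

variable {Γ} {A B : SymmetricComposition F} {f : (L ⊗[F] A.S) ≃ₗ[L] V}
  {f' : (L ⊗[F] B.S) ≃ₗ[L] V}

theorem conjHat_apply (x : L ⊗[F] A.S) : Γ.conjHat A f (f x) = f (A.hatEquiv Γ.ρ x) :=
  congrArg (fun z => f (A.hatEquiv Γ.ρ z)) (f.symm_apply_apply x)

theorem conjHat_smul (a : L) (x : V) : Γ.conjHat A f (a • x) = Γ.ρ a • Γ.conjHat A f x := by
  obtain ⟨x, rfl⟩ := f.surjective x
  rw [← map_smul, conjHat_apply, conjHat_apply, SymmetricComposition.hatEquiv_smul, map_smul]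

theorem conjHat_cube (x : V) : Γ.conjHat A f (Γ.conjHat A f (Γ.conjHat A f x)) = x := by
  obtain ⟨x, rfl⟩ := f.surjective x
  rw [conjHat_apply, conjHat_apply, conjHat_apply, A.hatEquiv_cube]

theorem tau_eq : Γ.tau A f = semilinearInt Γ.ρ (Γ.conjHat A f) conjHat_smul := rfl

/-- Turns an intertwining relation between semilinear maps into conjugacy of the automorphisms they
induce. -/
theorem conj_tau_eq {ν : L ≃ₐ[F] L} {g : V ≃ₗ[F] V} (hg : ∀ (a : L) x, g (a • x) = ν a • g x)
    (hν : ∀ a, ν (Γ.ρ a) = Γ.ρ (ν a))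
    (h : ∀ x, g (Γ.conjHat A f x) = Γ.conjHat B f' (g x)) :
    semilinearInt ν g hg * Γ.tau A f * (semilinearInt ν g hg)⁻¹ = Γ.tau B f' := by
  rw [mul_inv_eq_iff_eq_mul, tau_eq, tau_eq, semilinearInt_mul, semilinearInt_mul]
  congr 1
  · exact AlgEquiv.ext hν
  · exact LinearEquiv.ext h

variable [NeZero (2 : F)]

theorem inducedCyclic_mul (K : CyclicCubic F L) (x y : L ⊗[F] A.S) :
    (A.inducedCyclic K).mul x y =
      A.mulBaseChange L (A.hatEquiv K.ρ x) (A.hatEquiv K.ρ (A.hatEquiv K.ρ y)) := rfl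

theorem hatEquiv_inducedCyclic_mul (K : CyclicCubic F L) (x y : L ⊗[F] A.S) :
    A.hatEquiv K.ρ ((A.inducedCyclic K).mul x y) =
      (A.inducedCyclic K).mul (A.hatEquiv K.ρ x) (A.hatEquiv K.ρ y) := by
  rw [inducedCyclic_mul, inducedCyclic_mul, A.hatEquiv_mul]

theorem IsLinearIsotopy.exists_mul (hf : Γ.IsLinearIsotopy A f) : ∃ μ : L, μ ≠ 0 ∧
    ∀ x y, Γ.mul (f x) (f y) = μ • f ((A.inducedCyclic Γ.toCyclicCubic).mul x y) := by
  obtain ⟨-, -, μ, -, h⟩ := hf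
  exact ⟨μ, μ.ne_zero, h⟩

theorem isIsotopy_conjHat (hf : Γ.IsLinearIsotopy A f) :
    IsIsotopy Γ Γ Γ.ρ (Γ.conjHat A f) := by
  obtain ⟨μ, hμ, h⟩ := hf.exists_mul
  -- Since ρ̂ is multiplicative on Σ ⊗ (L, ρ), the multiplier μ' of f∘ρ̂∘f⁻¹ only has to satisfy
  -- ρ(μ')ρ(μ) = μ.
  refine isIsotopy_of_mul (fun _ => rfl) conjHat_smul (μ := Γ.ρ (Γ.ρ μ) * μ⁻¹)
    (mul_ne_zero (by simpa using hμ) (inv_ne_zero hμ)) fun x y => ?_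
  obtain ⟨x, rfl⟩ := f.surjective x
  obtain ⟨y, rfl⟩ := f.surjective y
  rw [conjHat_apply, conjHat_apply, h, h, conjHat_smul, conjHat_apply,
    hatEquiv_inducedCyclic_mul, smul_smul]
  congr 1
  rw [map_mul, Γ.ρ_cube, map_inv₀, inv_mul_cancel_right₀ (by simpa using hμ)]

theorem tau_mem (hf : Γ.IsLinearIsotopy A f) : Γ.tau A f ∈ Γ.autEnd :=
  (isIsotopy_conjHat hf).semilinearInt_mem conjHat_smul

theorem tau_mem_trialityClasses (hf : Γ.IsLinearIsotopy A f) :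
    ConjClasses.mk ⟨Γ.tau A f, tau_mem hf⟩ ∈ Γ.trialityClasses := by
  refine ⟨_, rfl, Subtype.ext ?_, semilinearInt_algebraMap conjHat_smul⟩
  ext φ x
  obtain ⟨x, rfl⟩ := (Γ.conjHat A f).surjective x
  obtain ⟨x, rfl⟩ := (Γ.conjHat A f).surjective x
  obtain ⟨x, rfl⟩ := (Γ.conjHat A f).surjective x
  change (Γ.tau A f ^ 3) φ _ = φ _
  rw [tau_eq, pow_three]
  rw [AlgEquiv.mul_apply, AlgEquiv.mul_apply, semilinearInt_apply, LinearEquiv.symm_apply_apply, semilinearInt_apply,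
    LinearEquiv.symm_apply_apply, semilinearInt_apply, LinearEquiv.symm_apply_apply,
    conjHat_cube, conjHat_cube]

/-- The conjugacy class of `τ_{(Σ, f)}` depends only on the isomorphism class of `Σ`. -/
theorem mk_tau_eq_of_iso (e : A.Iso B) (hf : Γ.IsLinearIsotopy A f)
    (hf' : Γ.IsLinearIsotopy B f') :
    ConjClasses.mk (⟨Γ.tau A f, tau_mem hf⟩ : Γ.autEnd) =
      ConjClasses.mk ⟨Γ.tau B f', tau_mem hf'⟩ := by
  obtain ⟨E, hE⟩ : ∃ E : (L ⊗[F] A.S) ≃ₗ[L] (L ⊗[F] B.S),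
      ∀ a s, E (a ⊗ₜ s) = a ⊗ₜ e.toEquiv s :=
    ⟨TensorProduct.AlgebraTensorModule.congr (LinearEquiv.refl L L) e.toEquiv, fun a s => rfl⟩
  have hEhat : ∀ x, E (A.hatEquiv Γ.ρ x) = B.hatEquiv Γ.ρ (E x) := fun x => by
    induction x with
    | zero => simp
    | add x y hx hy => simp only [map_add, hx, hy]
    | tmul a s => simp [hE]
  have hEmul : ∀ x y, E (A.mulBaseChange L x y) = B.mulBaseChange L (E x) (E y) := fun x y => by
    induction x with
    | zero => simp
    | add x x' hx hx' => simp only [map_add, LinearMap.add_apply, hx, hx']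
    | tmul a s =>
      induction y with
      | zero => simp
      | add y y' hy hy' => simp only [map_add, hy, hy']
      | tmul b r => simp [hE, e.map_mul]
  -- The conjugating isotopy is f' ∘ (1 ⊗ e) ∘ f⁻¹, which intertwines the two maps because 1 ⊗ e
  -- commutes with ρ̂.
  obtain ⟨g, hg, hgf⟩ : ∃ g : V ≃ₗ[F] V,
      (∀ (a : L) x, g (a • x) = (AlgEquiv.refl : L ≃ₐ[F] L) a • g x) ∧
        ∀ x, g (f x) = f' (E x) :=
    ⟨((f.symm.trans E).trans f').restrictScalars F, ((f.symm.trans E).trans f').map_smul,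
      fun x => by simp⟩
  obtain ⟨μ, hμ, h⟩ := hf.exists_mul
  obtain ⟨μ', hμ', h'⟩ := hf'.exists_mul
  have hgI : IsIsotopy Γ Γ AlgEquiv.refl g := by
    refine isIsotopy_of_mul (fun _ => rfl) hg (μ := μ' * μ⁻¹)
      (mul_ne_zero hμ' (inv_ne_zero hμ)) fun x y => ?_
    obtain ⟨x, rfl⟩ := f.surjective x
    obtain ⟨y, rfl⟩ := f.surjective y
    rw [hgf, hgf, h, h', hg, hgf, smul_smul, AlgEquiv.coe_refl, id, id,
      inv_mul_cancel_right₀ hμ, inducedCyclic_mul, inducedCyclic_mul, hEmul, hEhat, hEhat, hEhat]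
  have hconj := conj_tau_eq (f := f) (f' := f') hg (fun _ => rfl) fun x => by
    obtain ⟨x, rfl⟩ := f.surjective x
    rw [conjHat_apply, hgf, hgf, conjHat_apply, hEhat]
  exact ConjClasses.mk_eq_mk_iff_isConj.2 (isConj_iff.2
    ⟨⟨_, hgI.semilinearInt_mem hg⟩, Subtype.ext hconj⟩)

end ConjHat

end CyclicComposition

/-! ### Symmetric compositions are determined by their product, up to scaling. -/

namespace SymmetricComposition

variable {F : Type u} [Field F] (A : SymmetricComposition F)

theorem finiteDimensional : FiniteDimensional F A.S :=
  Module.finite_of_finrank_pos (by rw [A.finrank_eq]; norm_num)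

theorem nontrivial : Nontrivial A.S :=
  Module.nontrivial_of_finrank_pos (R := F) (by rw [A.finrank_eq]; norm_num)

theorem mul_mul_self (x y : A.S) : A.mul (A.mul x y) x = A.n x • y := by
  rw [← sub_eq_zero]
  apply A.nondegenerate.1
  intro z
  rw [map_sub, LinearMap.sub_apply, A.polar_mul, A.polar_mul_right, map_smul,
    LinearMap.smul_apply, smul_eq_mul, sub_self]

theorem exists_mul_self_ne_zero : ∃ x, A.mul x x ≠ 0 := by
  by_contra! h
  have := A.nontrivial
  obtain ⟨x, hx⟩ := exists_ne (0 : A.S)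
  have hn : ∀ y, A.n y = 0 := fun y => by
    have := A.n_mul y y
    rw [h, QuadraticMap.map_zero] at this
    exact mul_self_eq_zero.1 this.symm
  refine hx (A.nondegenerate.1 x fun y => ?_)
  simp [QuadraticMap.polar, hn]

variable {A}

/-- A linear bijection multiplicative up to a scalar can be rescaled to an isomorphism. -/
theorem nonempty_iso_of_map_mul {B : SymmetricComposition F} (i : A.S ≃ₗ[F] B.S) {c : F}
    (hc : c ≠ 0) (h : ∀ x y, B.mul (i x) (i y) = c • i (A.mul x y)) : Nonempty (A.Iso B) := by
  let e : A.S ≃ₗ[F] B.S := i.trans (LinearEquiv.smulOfNeZero F B.S c⁻¹ (inv_ne_zero hc))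
  have he : ∀ x, e x = c⁻¹ • i x := fun x => rfl
  have hmul : ∀ x y, e (A.mul x y) = B.mul (e x) (e y) := fun x y => by
    simp only [he, map_smul, LinearMap.smul_apply, h, inv_smul_smul₀ hc]
  refine ⟨e, fun x => ?_, hmul⟩
  have := A.nontrivial
  obtain ⟨y, hy⟩ := exists_ne (0 : A.S)
  have h1 := B.mul_mul_self (e x) (e y)
  rw [← hmul, ← hmul, mul_mul_self, map_smul] at h1
  exact (smul_left_injective F (e.map_ne_zero_iff.2 hy) h1).symm

end SymmetricComposition

/-! ### Injectivity: conjugate automorphisms come from isomorphic symmetric compositions. -/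

namespace CyclicComposition

section Main

variable {F : Type u} {L : Type v} {V : Type w} [Field F] [NeZero (2 : F)] [Field L] [Algebra F L]
  [AddCommGroup V] [Module F V] [Module L V] [IsScalarTower F L V]
  {Γ : CyclicComposition F L V} {A B : SymmetricComposition F} {f : (L ⊗[F] A.S) ≃ₗ[L] V}
  {f' : (L ⊗[F] B.S) ≃ₗ[L] V}

/-- If `τ_{(Σ, f)}` and `τ_{(Σ', f')}` are conjugate, then `Σ` and `Σ'` are isomorphic. -/
theorem nonempty_iso_of_mk_tau_eq (hf : Γ.IsLinearIsotopy A f) (hf' : Γ.IsLinearIsotopy B f')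
    (h : ConjClasses.mk (⟨Γ.tau A f, tau_mem hf⟩ : Γ.autEnd) =
      ConjClasses.mk ⟨Γ.tau B f', tau_mem hf'⟩) : Nonempty (A.Iso B) := by
  have := Γ.nontrivial
  have hfinA := A.finiteDimensional
  have hfinB := B.finiteDimensional
  obtain ⟨⟨φ, hφ⟩, hconj⟩ := isConj_iff.1 (ConjClasses.mk_eq_mk_iff_isConj.1 h)
  obtain ⟨ν, g, hg, hgI, rfl⟩ := exists_isIsotopy_of_mem_autEnd hφ
  have h1 : semilinearInt ν g hg * Γ.tau A f = Γ.tau B f' * semilinearInt ν g hg :=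
    mul_inv_eq_iff_eq_mul.1 (congrArg Subtype.val hconj)
  obtain ⟨hν, -, μ, -, hmul⟩ := hgI
  rw [tau_eq, tau_eq, semilinearInt_mul, semilinearInt_mul] at h1
  obtain ⟨c, -, hc⟩ := exists_smul_of_semilinearInt_eq _ _ h1
  replace hc : ∀ x, g (Γ.conjHat A f x) = c • Γ.conjHat B f' (g x) := hc
  -- Moving g three times past f∘ρ̂∘f⁻¹ and its counterpart for f', both of cube 1, collects the
  -- norm of c.
  have hN : c * Γ.ρ c * Γ.ρ (Γ.ρ c) = 1 := by
    obtain ⟨x, hx⟩ := exists_ne (0 : V)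
    apply smul_left_injective L (g.map_ne_zero_iff.2 hx)
    have h2 := congrArg g (conjHat_cube (Γ := Γ) (f := f) x)
    rw [hc, hc, hc, conjHat_smul, conjHat_smul, conjHat_smul, conjHat_cube, smul_smul,
      smul_smul] at h2
    simpa using h2
  obtain ⟨η, hη0, hη⟩ := Γ.toCyclicCubic.exists_ρ_eq_mul hN
  obtain ⟨μA, hμA, hA⟩ := hf.exists_mul
  obtain ⟨μB, hμB, hB⟩ := hf'.exists_mul
  -- The relation ρ(η) = cη makes ηg intertwine the two maps exactly, so it sends f(1 ⊗ s) to a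
  -- fixed vector, which descends to F.
  have hi : ∀ s, ∃ s', f' (1 ⊗ₜ s') = η • g (f (1 ⊗ₜ s)) := fun s => by
    obtain ⟨z, hz⟩ := f'.surjective (η • g (f (1 ⊗ₜ s)))
    have hfix : Γ.conjHat B f' (f' z) = f' z := by
      rw [hz, conjHat_smul, hη, mul_comm, ← smul_smul, ← hc, conjHat_apply,
        SymmetricComposition.hatEquiv_tmul, map_one]
    rw [conjHat_apply] at hfix
    obtain ⟨s', rfl⟩ := Γ.toCyclicCubic.exists_eq_one_tmul (Module.finBasis F B.S)
      (f'.injective hfix)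
    exact ⟨s', hz⟩
  choose i hi using hi
  have hinj : ∀ {s s' : B.S}, f' (1 ⊗ₜ s) = f' (1 ⊗ₜ s') → s = s' := fun h =>
    CyclicCubic.one_tmul_injective (f'.injective h)
  have hfF : ∀ (a : F) z, f (a • z) = a • f z := (f.restrictScalars F).map_smul
  have hfF' : ∀ (a : F) z, f' (a • z) = a • f' z := (f'.restrictScalars F).map_smul
  let I : A.S →ₗ[F] B.S :=
    { toFun := i
      map_add' := fun x y => hinj (by simp only [hi, TensorProduct.tmul_add, map_add, smul_add])
      map_smul' := fun a x => hinj (by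
        rw [RingHom.id_apply, hi, TensorProduct.tmul_smul, TensorProduct.tmul_smul,
          hfF', hfF, map_smul, hi, smul_comm]) }
  have hI : Function.Injective I := (injective_iff_map_eq_zero I).2 fun s hs => by
    have h2 := hi s
    change i s = 0 at hs
    rw [hs, TensorProduct.tmul_zero, map_zero, eq_comm, smul_eq_zero_iff_right hη0,
      g.map_eq_zero_iff, f.map_eq_zero_iff] at h2
    exact CyclicCubic.one_tmul_injective (h2.trans (TensorProduct.tmul_zero _ _).symm)
  have hmulS : ∀ (C : SymmetricComposition F) (x y : C.S),
      (C.inducedCyclic Γ.toCyclicCubic).mul (1 ⊗ₜ x) (1 ⊗ₜ y) = 1 ⊗ₜ C.mul x y :=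
    fun C x y => by simp [inducedCyclic_mul]
  obtain ⟨κ, hκ0, hκ⟩ : ∃ κ : L, κ ≠ 0 ∧ ∀ x y,
      (1 : L) ⊗ₜ[F] B.mul (i x) (i y) = κ • (1 ⊗ₜ i (A.mul x y)) := by
    refine ⟨μB⁻¹ * (Γ.ρ η * Γ.ρ (Γ.ρ η) * (ν μ * (ν μA * η⁻¹))), ?_, fun x y => ?_⟩
    · simp [hμA, hμB, hη0]
    apply f'.injective
    have h2 := hB (1 ⊗ₜ i x) (1 ⊗ₜ i y)
    have h3 : g (f (1 ⊗ₜ A.mul x y)) = η⁻¹ • f' (1 ⊗ₜ i (A.mul x y)) := by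
      rw [hi, inv_smul_smul₀ hη0]
    rw [hmulS, hi, hi, Γ.smul_mul, Γ.mul_smul, hmul, hA, hmulS, hg, h3] at h2
    rw [map_smul, ← smul_smul μB⁻¹, eq_inv_smul_iff₀ hμB, ← h2]
    simp only [smul_smul]
    congr 1
    ring
  obtain ⟨x₀, hx₀⟩ := A.exists_mul_self_ne_zero
  -- Both 1 ⊗ i(x)⋆i(y) and 1 ⊗ i(x⋆y) are fixed by ρ̂; one nonzero square x₀⋆x₀ then shows that κ
  -- lies in F.
  have hκρ : Γ.ρ κ = κ := by
    have h2 := congrArg (B.hatEquiv Γ.ρ) (hκ x₀ x₀)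
    rw [SymmetricComposition.hatEquiv_smul, SymmetricComposition.hatEquiv_tmul,
      SymmetricComposition.hatEquiv_tmul, map_one, hκ] at h2
    have hne : (1 : L) ⊗ₜ[F] i (A.mul x₀ x₀) ≠ 0 := fun h3 => hx₀ (hI (by
      rw [map_zero]
      exact CyclicCubic.one_tmul_injective (h3.trans (TensorProduct.tmul_zero _ _).symm)))
    exact smul_left_injective L hne h2.symm
  obtain ⟨k, rfl⟩ := Γ.toCyclicCubic.exists_algebraMap_eq hκρ
  refine SymmetricComposition.nonempty_iso_of_map_mul
    (I.linearEquivOfInjective hI (A.finrank_eq.trans B.finrank_eq.symm)) (c := k) ?_ fun x y => ?_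
  · rintro rfl; simp at hκ0
  · apply CyclicCubic.one_tmul_injective (F := F) (L := L)
    refine (hκ x y).trans ?_
    rw [algebraMap_smul, ← TensorProduct.tmul_smul]
    rfl

end Main


/-! ### Surjectivity: descending Γ along a semilinear isotopy of order 3. -/

section Descent

variable {F : Type u} {L : Type v} {V : Type w} [Field F] [Field L] [Algebra F L]
  [AddCommGroup V] [Module F V] [Module L V] [IsScalarTower F L V]
  {Γ : CyclicComposition F L V}

/-- A `ρ`-semilinear self-isotopy whose cube is a scalar can be rescaled to have cube `1`. -/
theorem exists_rescale_cube_eq_one {t : V ≃ₗ[F] V} (ht : ∀ (a : L) x, t (a • x) = Γ.ρ a • t x)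
    {μ : L} (hμ : μ ≠ 0) (hmul : ∀ x y, Γ.mul (t x) (t y) = μ • t (Γ.mul x y))
    {c : L} (hc : ∀ x, t (t (t x)) = c • x) :
    ∃ t' : V ≃ₗ[F] V, (∀ x, t' x = μ⁻¹ • t x) ∧ (∀ (a : L) x, t' (a • x) = Γ.ρ a • t' x) ∧
      (∀ x, t' (t' (t' x)) = x) ∧ ∀ x y, t' x = x → t' y = y →
        t' ((Γ.ρ (Γ.ρ μ) * μ⁻¹) • Γ.mul x y) = (Γ.ρ (Γ.ρ μ) * μ⁻¹) • Γ.mul x y := by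
  have hρ : ∀ {a : L}, a ≠ 0 → Γ.ρ a ≠ 0 := fun ha => by simpa using ha
  obtain ⟨x₀, hx₀⟩ := Γ.exists_Q_ne_zero
  have hx₀' : x₀ ≠ 0 := by rintro rfl; exact hx₀ (QuadraticMap.map_zero _)
  have hρc : Γ.ρ c = c := by
    refine smul_left_injective L (t.map_ne_zero_iff.2 hx₀') ?_
    change Γ.ρ c • t x₀ = c • t x₀
    rw [← ht, ← hc, ← hc]
  have hc0 : c ≠ 0 := by
    rintro rfl
    have h1 := hc x₀
    rw [zero_smul, t.map_eq_zero_iff, t.map_eq_zero_iff, t.map_eq_zero_iff] at h1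
    exact hx₀' h1
  -- Evaluate t³(x₀)*t³(x₀) in two ways: as c²(x₀*x₀), and through the multiplier as N(μ)c(x₀*x₀).
  have hcN : c = μ * Γ.ρ μ * Γ.ρ (Γ.ρ μ) := by
    have hne : Γ.mul x₀ x₀ ≠ 0 := fun h0 => hx₀' (Γ.eq_zero_of_mul_left hx₀ h0)
    have h1 : (c * c) • Γ.mul x₀ x₀ =
        (μ * Γ.ρ μ * Γ.ρ (Γ.ρ μ) * c) • Γ.mul x₀ x₀ := by
      have h2 := hmul (t (t x₀)) (t (t x₀))
      rw [hc, hmul, hmul, Γ.smul_mul, Γ.mul_smul, hρc, hρc] at h2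
      simp only [ht, hc, smul_smul, map_mul] at h2
      rw [h2]
      congr 1
      ring
    exact mul_right_cancel₀ hc0 (smul_left_injective L hne h1)
  let t' : V ≃ₗ[F] V :=
    t.trans ((LinearEquiv.smulOfNeZero L V μ⁻¹ (inv_ne_zero hμ)).restrictScalars F)
  have ht' : ∀ x, t' x = μ⁻¹ • t x := fun x => rfl
  refine ⟨t', ht', fun a x => by rw [ht', ht', ht, smul_comm], fun x => ?_,
    fun x y hx hy => ?_⟩
  · simp only [ht', ht, hc, smul_smul, map_mul, map_inv₀]
    rw [hcN]
    convert one_smul L x using 2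
    have := hρ hμ
    have := hρ this
    field_simp
  · rw [ht', inv_smul_eq_iff₀ hμ] at hx hy
    have h1 := hmul x y
    rw [hx, hy, Γ.smul_mul, Γ.mul_smul, smul_smul, ← inv_smul_eq_iff₀ hμ] at h1
    rw [ht', ht, ← h1, map_mul, map_inv₀, Γ.ρ_cube, smul_smul, smul_smul, smul_smul]
    congr 1
    have := hρ hμ
    field_simp

variable [NeZero (2 : F)]

/-- The symmetric composition on the fixed points of `t`. -/
theorem exists_symmetricComposition {t : V ≃ₗ[F] V}
    (ht : ∀ (a : L) x, t (a • x) = Γ.ρ a • t x) (ht3 : ∀ x, t (t (t x)) = x)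
    {η : L} (hη : η * Γ.ρ η * Γ.ρ (Γ.ρ η) = 1)
    (hfix : ∀ x y, t x = x → t y = y → t (η • Γ.mul x y) = η • Γ.mul x y) :
    ∃ (A : SymmetricComposition.{u} F) (f : (L ⊗[F] A.S) ≃ₗ[L] V),
      Γ.IsLinearIsotopy A f ∧ Γ.conjHat A f = t := by
  have hη0 : η ≠ 0 := by rintro rfl; simp at hη
  obtain ⟨b, hb⟩ := Γ.toCyclicCubic.exists_fixed_basis (by norm_num) Γ.finrank_eq_eight ht ht3
  let bS := Pi.basisFun F (Fin 8)
  let f : (L ⊗[F] (Fin 8 → F)) ≃ₗ[L] V := (Module.Basis.baseChange L bS).equiv b (Equiv.refl _)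
  have hfb : ∀ i, f (1 ⊗ₜ bS i) = b i := fun i => by
    have := (Module.Basis.baseChange L bS).equiv_apply i b (Equiv.refl _)
    rwa [Module.Basis.baseChange_apply] at this
  clear_value f
  let H : (L ⊗[F] (Fin 8 → F)) ≃ₗ[F] (L ⊗[F] (Fin 8 → F)) :=
    TensorProduct.congr Γ.ρ.toLinearEquiv (LinearEquiv.refl F _)
  have hfF : ∀ (a : F) x, f (a • x) = a • f x := (f.restrictScalars F).map_smul
  let j : (Fin 8 → F) →ₗ[F] V :=
    { toFun := fun s => f (1 ⊗ₜ s)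
      map_add' := fun x y => by rw [TensorProduct.tmul_add, map_add]
      map_smul' := fun a x => by rw [TensorProduct.tmul_smul, hfF, RingHom.id_apply] }
  have hj : ∀ s, f (1 ⊗ₜ s) = j s := fun s => rfl
  have hfj : ∀ a s, f (a ⊗ₜ s) = a • j s := fun a s => by
    rw [← hj, ← map_smul, TensorProduct.smul_tmul', smul_eq_mul, mul_one]
  have hjinj : Function.Injective j := fun x y h =>
    CyclicCubic.one_tmul_injective (f.injective h)
  have htj : ∀ s, t (j s) = j s := by
    have : t.toLinearMap ∘ₗ j = j := bS.ext fun i => by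
      change t (f _) = f _
      rw [hfb, hb]
    exact fun s => LinearMap.congr_fun this s
  have htf : ∀ x, t (f x) = f (H x) := fun x => by
    induction x with
    | zero => simp
    | add x y hx hy => simp only [map_add, hx, hy]
    | tmul a s =>
      change _ = f (Γ.ρ a ⊗ₜ s)
      rw [hfj, hfj, ht, htj]
  have hex : ∀ v, t v = v → ∃ s, j s = v := fun v hv => by
    obtain ⟨x, rfl⟩ := f.surjective v
    rw [htf] at hv
    obtain ⟨s, rfl⟩ := Γ.toCyclicCubic.exists_eq_one_tmul bS (f.injective hv)
    exact ⟨s, rfl⟩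
  have hstar : ∀ x y, ∃ s, j s = η • Γ.mul (j x) (j y) := fun x y =>
    hex _ (hfix _ _ (htj x) (htj y))
  choose star hstar using hstar
  have hN : ∀ x, ∃ c : F, algebraMap F L c = η⁻¹ * Γ.Q (j x) := fun x => by
    refine Γ.toCyclicCubic.exists_algebraMap_eq ?_
    obtain ⟨y, hy⟩ := exists_ne (0 : Fin 8 → F)
    -- The descended product stays among the fixed vectors, so the scalar in (x⋆y)⋆x is fixed by ρ.
    -- As ηρ(η) = ρ²(η)⁻¹, this scalar is ρ²(η⁻¹Q(x)), which dictates the norm n(x) = η⁻¹Q(x).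
    have h1 : j (star (star x y) x) = (Γ.ρ (Γ.ρ (η⁻¹ * Γ.Q (j x)))) • j y := by
      rw [hstar, hstar, Γ.smul_mul, Γ.mul_mul_self, smul_smul, smul_smul, θ_apply, map_mul,
        map_mul, map_inv₀, map_inv₀]
      congr 2
      exact eq_inv_of_mul_eq_one_left hη
    have h2 := htj (star (star x y) x)
    rw [h1, ht, htj, Γ.ρ_cube] at h2
    have h3 := smul_left_injective L ((map_ne_zero_iff j hjinj).2 hy) h2
    nth_rewrite 1 [h3]
    exact Γ.ρ_cube _
  choose n hn using hN
  have halg := (algebraMap F L).injective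
  have hP : ∀ x y, algebraMap F L (n (x + y) - n x - n y) =
      η⁻¹ * Γ.polarForm (j x) (j y) := fun x y => by
    rw [map_sub, map_sub, hn, hn, hn, map_add, Q_add]
    ring
  let P : (Fin 8 → F) →ₗ[F] (Fin 8 → F) →ₗ[F] F := LinearMap.mk₂ F
    (fun x y => n (x + y) - n x - n y)
    (fun x x' y => halg (by
      rw [map_add, hP, hP, hP]; simp only [map_add, LinearMap.add_apply, mul_add]))
    (fun c x y => halg (by
      rw [smul_eq_mul, map_mul, hP, hP, map_smul, ← algebraMap_smul L c]
      simp only [map_smul, LinearMap.smul_apply, smul_eq_mul]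
      ring))
    (fun x y y' => halg (by
      rw [map_add, hP, hP, hP]; simp only [map_add, mul_add]))
    (fun c x y => halg (by
      rw [smul_eq_mul, map_mul, hP, hP, map_smul, ← algebraMap_smul L c]
      simp only [map_smul, smul_eq_mul]
      ring))
  let N : QuadraticForm F (Fin 8 → F) :=
    { toFun := n
      toFun_smul := fun c x => halg (by
        rw [smul_eq_mul, map_mul, map_mul, hn, hn, map_smul, ← algebraMap_smul L c,
          QuadraticMap.map_smul, smul_eq_mul]
        ring)
      exists_companion' := ⟨P, fun x y => by
        change _ = _ + (n (x + y) - n x - n y)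
        ring⟩ }
  have hPN : ∀ x y, algebraMap F L (QuadraticMap.polarBilin N x y) =
      η⁻¹ * Γ.polarForm (j x) (j y) := hP
  have hnd : ∀ x, (∀ y, QuadraticMap.polarBilin N x y = 0) → x = 0 := fun x hx => by
    apply hjinj
    rw [map_zero]
    apply Γ.nondegenerate.1
    intro y
    have : Γ.polarForm (j x) = 0 := b.ext fun i => by
      have h1 := hPN x (bS i)
      rw [hx, map_zero, zero_eq_mul, ← hj (bS i), hfb] at h1
      exact h1.resolve_left (inv_ne_zero hη0)
    rw [this, LinearMap.zero_apply]
  let A : SymmetricComposition.{u} F :=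
    { S := Fin 8 → F
      finrank_eq := by simp
      n := N
      nondegenerate := ⟨hnd, fun y hy => hnd y fun x => by
        rw [← hy x]; exact QuadraticMap.polar_comm _ _ _⟩
      mul := LinearMap.mk₂ F star
        (fun x x' y => hjinj (by
          simp only [map_add, hstar, LinearMap.add_apply, smul_add]))
        (fun c x y => hjinj (by
          simp only [map_smul, hstar, LinearMap.smul_apply, smul_comm c η]))
        (fun x y y' => hjinj (by
          simp only [map_add, hstar, smul_add]))
        (fun c x y => hjinj (by
          simp only [map_smul, hstar, smul_comm c η]))
      n_mul := fun x y => halg (by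
        change algebraMap F L (n (star x y)) = algebraMap F L (n x * n y)
        -- Since n takes values in F, n(x) = ρ(η⁻¹Q(x)) and n(y) = ρ²(η⁻¹Q(y)); multiplicativity
        -- then comes down to η having norm 1.
        have hx := congrArg Γ.ρ (hn x)
        have hy := congrArg (fun z => Γ.ρ (Γ.ρ z)) (hn y)
        simp only [AlgEquiv.commutes, map_mul, map_inv₀] at hx hy
        rw [map_mul, hn, hx, hy, hstar, QuadraticMap.map_smul, Γ.Q_mul, smul_eq_mul]
        have h1 : Γ.ρ η ≠ 0 := by simpa using hη0
        have h2 : Γ.ρ (Γ.ρ η) ≠ 0 := by simpa using hη0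
        field_simp
        linear_combination (Γ.ρ (Γ.Q (j x)) * Γ.ρ (Γ.ρ (Γ.Q (j y)))) * hη)
      polar_mul := fun x y z => halg (by
        change algebraMap F L (QuadraticMap.polarBilin N (star x y) z) =
          algebraMap F L (QuadraticMap.polarBilin N x (star y z))
        have h1 := congrArg Γ.ρ (hPN x (star y z))
        rw [AlgEquiv.commutes] at h1
        rw [h1, hPN, hstar, hstar, map_smul, map_smul, LinearMap.smul_apply, smul_eq_mul,
          smul_eq_mul, inv_mul_cancel_left₀ hη0, inv_mul_cancel_left₀ hη0, Γ.polar_mul,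
          Γ.polar_symm]) }
  refine ⟨A, f, isIsotopy_of_mul (fun _ => rfl) f.map_smul (μ := η⁻¹) (inv_ne_zero hη0)
    fun x y => ?_, ?_⟩
  · change Γ.mul (f x) (f y) = η⁻¹ • f ((A.inducedCyclic Γ.toCyclicCubic).mul x y)
    induction x with
    | zero => simp
    | add x x' hx hx' => simp only [map_add, LinearMap.add_apply, smul_add, hx, hx']
    | tmul a s =>
      induction y with
      | zero => simp
      | add y y' hy hy' => simp only [map_add, smul_add, hy, hy']
      | tmul c r =>
        rw [inducedCyclic_mul]
        simp only [SymmetricComposition.hatEquiv_tmul, SymmetricComposition.mulBaseChange_tmul]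
        change Γ.mul (f (a ⊗ₜ[F] (s : Fin 8 → F))) (f (c ⊗ₜ[F] (r : Fin 8 → F))) =
          η⁻¹ • f ((Γ.ρ a * Γ.ρ (Γ.ρ c)) ⊗ₜ[F] star s r)
        rw [hfj, hfj, hfj, hstar, Γ.smul_mul, Γ.mul_smul, smul_smul, smul_smul, smul_smul]
        congr 1
        field_simp
  · ext v
    obtain ⟨x, rfl⟩ := f.surjective v
    exact (conjHat_apply (A := A) (f := f) x).trans (htf x).symm

end Descent


variable {F : Type u} {L : Type v} {V : Type w} [Field F] [NeZero (2 : F)] [Field L] [Algebra F L]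
  [AddCommGroup V] [Module F V] [Module L V] [IsScalarTower F L V]
  {Γ : CyclicComposition F L V}

/-- Every automorphism `τ` of `End Γ` with `τ³ = 1` and `τ|_L = ρ` is of the form `τ_{(Σ, f)}`. -/
theorem exists_tau_eq {τ : Module.End L V ≃ₐ[F] Module.End L V} (hτ : τ ∈ Γ.autEnd)
    (hτ3 : τ ^ 3 = 1) (hτρ : ∀ a : L, τ (algebraMap L _ a) = algebraMap L _ (Γ.ρ a)) :
    ∃ (A : SymmetricComposition.{u} F) (f : (L ⊗[F] A.S) ≃ₗ[L] V),
      Γ.IsLinearIsotopy A f ∧ Γ.tau A f = τ := by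
  have := Γ.nontrivial
  obtain ⟨ν, t, ht, hI, rfl⟩ := exists_isIsotopy_of_mem_autEnd hτ
  obtain rfl : ν = Γ.ρ := AlgEquiv.ext fun a =>
    (algebraMap L (Module.End L V)).injective (by
      rw [← hτρ, semilinearInt_algebraMap])
  obtain ⟨-, -, μ, -, hmul⟩ := hI
  -- Int(t³) = 1 = Int(id), so t³ is a scalar.
  obtain ⟨c, -, hc⟩ : ∃ c : L, c ≠ 0 ∧ ∀ x, (t.trans (t.trans t)) x =
      c • (LinearEquiv.refl F V) x := by
    refine exists_smul_of_semilinearInt_eq (ν := Γ.ρ.trans (Γ.ρ.trans Γ.ρ))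
      (ν' := AlgEquiv.refl) (fun a x => by simp [ht]) (fun a x => rfl) ?_
    exact (pow_three (semilinearInt Γ.ρ t ht)).symm.trans hτ3
  have hμ : Γ.ρ μ ≠ 0 := by simp
  obtain ⟨t', htt', ht', ht3, hfix⟩ := exists_rescale_cube_eq_one ht hμ hmul hc
  obtain ⟨A, f, hf, hft⟩ := exists_symmetricComposition ht' ht3 (by
    simp only [map_mul, map_inv₀, Γ.ρ_cube]
    have h2 : Γ.ρ (Γ.ρ (μ : L)) ≠ 0 := by simp
    field_simp [μ.ne_zero]) hfix
  refine ⟨A, f, hf, ?_⟩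
  subst hft
  exact semilinearInt_eq_of_smul conjHat_smul ht htt'

end CyclicComposition

theorem mainTheorem2 {F : Type u} {L : Type v} {V : Type w} [Field F] [NeZero (2 : F)]
    [Field L] [Algebra F L] [AddCommGroup V] [Module F V] [Module L V] [IsScalarTower F L V]
    (Γ : CyclicComposition F L V) :
    ∃ Φ : Γ.InducingClasses → Γ.trialityClasses, Function.Bijective Φ ∧
      ∀ (A : SymmetricComposition.{u} F) (f : (L ⊗[F] A.S) ≃ₗ[L] V)
        (hf : Γ.IsLinearIsotopy A f),
        ∃ hτ : Γ.tau A f ∈ Γ.autEnd,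
          (Φ (Γ.inducingClass A f hf) : ConjClasses Γ.autEnd) =
            ConjClasses.mk ⟨Γ.tau A f, hτ⟩ := by
  -- An isotopy is chosen for each Σ; the class is independent of the choice by `mk_tau_eq_of_iso`,
  -- applied in `hΦ` to the identity of Σ with two isotopies.
  let Φ : Γ.InducingClasses → Γ.trialityClasses := Quotient.lift
    (fun A : Γ.Inducing => ⟨_, CyclicComposition.tau_mem_trialityClasses A.2.choose_spec⟩)
    (fun A B ⟨e⟩ => Subtype.ext (CyclicComposition.mk_tau_eq_of_iso e A.2.choose_spec B.2.choose_spec))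
  have hΦ : ∀ A f (hf : Γ.IsLinearIsotopy A f), (Φ (Γ.inducingClass A f hf) :
      ConjClasses Γ.autEnd) = ConjClasses.mk ⟨Γ.tau A f, CyclicComposition.tau_mem hf⟩ := fun A f hf =>
    CyclicComposition.mk_tau_eq_of_iso ⟨LinearEquiv.refl F _, fun _ => rfl, fun _ _ => rfl⟩
      (⟨f, hf⟩ : ∃ f, Γ.IsLinearIsotopy A f).choose_spec hf
  refine ⟨Φ, ⟨?_, ?_⟩, fun A f hf => ⟨CyclicComposition.tau_mem hf, hΦ A f hf⟩⟩
  · rintro ⟨A, f, hf⟩ ⟨B, f', hf'⟩ h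
    have h1 := congrArg Subtype.val h
    exact Quotient.sound (CyclicComposition.nonempty_iso_of_mk_tau_eq hf hf'
      ((hΦ A f hf).symm.trans (h1.trans (hΦ B f' hf'))))
  · rintro ⟨_, ⟨τ, hτ⟩, rfl, hτ3, hτρ⟩
    obtain ⟨A, f, hf, rfl⟩ := CyclicComposition.exists_tau_eq hτ (congrArg Subtype.val hτ3) hτρ
    exact ⟨Γ.inducingClass A f hf, Subtype.ext (hΦ A f hf)⟩
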